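/- Let $\mathbb F$ be a field of characteristic $0$, $n\ge 1$, $m=2n-1$. Let $V(a)$ be the irreducible $\mathfrak{sl}(2)$-module of dimension $a+1$, let $\mathfrak h_n=V(m)\oplus\mathbb F z$ be the Heisenberg Lie algebra of dimension $2n+1$, with $z$ central and with bracket $V(m)\times V(m)\to\mathbb Fz$ the (unique up to scalar) non-zero $\mathfrak{sl}(2)$-invariant bilinear form, and let $\mathfrak g=\mathfrak{sl}(2)\ltimes\mathfrak h_n$. All the modules below are, as $\mathfrak{sl}(2)$-modules, sums $V(a_0)\oplus\cdots\oplus V(a_\ell)$ on which $V(m)\subset\mathfrak h_n$ maps $V(a_0)$ to $0$ and $V(a_{i})$ to $V(a_{i-1})$ through the (unique up to scalar) non-zero $\mathfrak{sl}(2)$-equivariant map $V(m)\otimes V(a_{i})\to V(a_{i-1})$. * Modules of type $Z$ ($z$ acts by $0$; $\alpha,\ell\ge0$): $Z(\alpha,\ell)=V(\alpha)\oplus V(\alpha+m)\oplus\cdots\oplus V(\alpha+\ell m)$ and $Z(\alpha,\ell)^*=V(\alpha+\ell m)\oplus\cdots\oplus V(\alpha+m)\oplus V(\alpha)$. * Standard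 faithful modules ($z$ maps $V(a_2)$ isomorphically onto $V(a_0)$ and kills $V(a_0)\oplus V(a_1)$). For $n=1$: $FU_a^+=V(a)\oplus V(a+1)\oplus V(a)$ ($a\ge0$) and $FU_a^-=V(a)\oplus V(a-1)\oplus V(a)$ ($a\ge1$). For $n\ge2$: $FU_{(0,m,0)}$, $FU_{(1,m+1,1)}$, $FU_{(1,m-1,1)}$, where $FU_{(a_0,a_1,a_2)}=V(a_0)\oplus V(a_1)\oplus V(a_2)$. Let $V=V(a_0)\oplus V(a_1)\oplus V(a_2)$ (so $a_0=a_2$) be standard faithful. **(A)** Let $W=V(b_0)\oplus\cdots\oplus V(b_\ell)$ be of type $Z$. (A1) $\dim\operatorname{Hom}_{\mathfrak g}(V,W)\le1$, and the dimension is $1$ exactly in the following cases. 1. $a_0=b_0$. Every non-zero homomorphism kills $V(a_0)\oplus V(a_1)$ and maps $V(a_2)$ isomorphically onto $V(b_0)$. 2. One of the cases: (a) $n=1$, $V=FU_{a_0}^-$, $W=Z(b_0,\ell)$, $\ell\ge1$, $a_0=b_1$; (b) $n=1$, $V=FU_{a_0}^+$, $W=Z(b_\ell,\ell)^*$, $\ell\ge1$,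 $a_0=b_1$; (c) $n>1$, $V=FU_{(a_0,a_0+m,a_0)}$ with $a_0\in\{0,1\}$, $W=Z(a_0,1)^*$. Every non-zero homomorphism kills $V(a_0)$ and maps $V(a_1)$ isomorphically onto $V(b_0)$ and $V(a_2)$ isomorphically onto $V(b_1)$. (A2) $\dim\operatorname{Hom}_{\mathfrak g}(W,V)\le1$, and the dimension is $1$ exactly in the following cases. 1. $a_0=b_\ell$. Every non-zero homomorphism kills $V(b_i)$ for $i<\ell$ and maps $V(b_\ell)$ isomorphically onto $V(a_0)$. 2. One of the cases: (a) $n=1$, $V=FU_{a_0}^+$, $W=Z(b_0,\ell)$, $\ell\ge1$, $a_0=b_{\ell-1}$; (b) $n=1$, $V=FU_{a_0}^-$, $W=Z(b_\ell,\ell)^*$, $\ell\ge1$, $a_0=b_{\ell-1}$; (c) $n>1$, $V=FU_{(a_0,a_0+m,a_0)}$ with $a_0\in\{0,1\}$, $W=Z(a_0,1)$. Every non-zero homomorphism kills $V(b_i)$ for $i<\ell-1$ and maps $V(b_{\ell-1})$ isomorphically onto $V(a_0)$ and $V(b_\ell)$ isomorphically onto $V(a_1)$. **(B)** Let $W=V(b_0)\oplus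 V(b_1)\oplus V(b_2)$ be standard faithful. (B1) If $a_0=b_0$, then $V\simeq W$ if and only if $a_1=b_1$. If $V\not\simeq W$, then $\dim\operatorname{Hom}_{\mathfrak g}(V,W)=1$ and every non-zero homomorphism kills $V(a_0)\oplus V(a_1)$ and maps $V(a_2)$ isomorphically onto $V(b_0)$. If $V\simeq W$, then $\dim\operatorname{Hom}_{\mathfrak g}(V,W)=2$, and $\operatorname{Hom}_{\mathfrak g}(V,W)$ is spanned by a homomorphism of this kind and an isomorphism that maps $V(a_i)$ onto $V(b_i)$ for $i=0,1,2$. (B2) If $n=1$ and either $V=FU_{a_0}^-$, $W=FU_{b_0}^+$, $a_0=b_1$, or $V=FU_{a_0}^+$, $W=FU_{b_0}^-$, $a_0=b_1$, then $\dim\operatorname{Hom}_{\mathfrak g}(V,W)=1$ and every non-zero homomorphism kills $V(a_0)$ and maps $V(a_1)$ isomorphically onto $V(b_0)$ and $V(a_2)$ isomorphically onto $V(b_1)$. (B3) In all other cases $\operatorname{Hom}_{\mathfrak g}(V,W)=0$. -/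

import Mathlib

namespace Galilean

noncomputable section

open Polynomial

variable {F : Type*} [Field F]

/-- The Lie algebra `sl(2)` of traceless `2 × 2` matrices. -/
abbrev SL2 (F : Type*) [Field F] : Type _ := LieAlgebra.SpecialLinear.sl (Fin 2) F

/-- The irreducible `sl(2)`-module `V(a)`, of dimension `a + 1`: binary forms of degree `a`, written
in one variable, that is, polynomials of degree at most `a`. -/
def irr (F : Type*) [Field F] (a : ℕ) : Submodule F F[X] := degreeLE F (a : WithBot ℕ)

/-- The action of `A = A₀₁ e + A₀₀ h + A₁₀ f` on `V(a)`:
`e p = p'`, `h p = a p - 2 X p'`, `f p = a X p - X² p'`. -/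
def slAct (a : ℕ) (A : SL2 F) : F[X] →ₗ[F] F[X] :=
  A.1 0 1 • derivative
    + A.1 0 0 • ((a : F) • LinearMap.id - (2 : F) • LinearMap.mulLeft F X ∘ₗ derivative)
    + A.1 1 0 • ((a : F) • LinearMap.mulLeft F X - LinearMap.mulLeft F (X ^ 2) ∘ₗ derivative)

theorem slAct_apply (a : ℕ) (A : SL2 F) (p : F[X]) :
    slAct a A p = C (A.1 0 1) * derivative p
      + C (A.1 0 0) * ((a : F[X]) * p - 2 * (X * derivative p))
      + C (A.1 1 0) * ((a : F[X]) * (X * p) - X ^ 2 * derivative p) := by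
  have h (c : F) (p : F[X]) : c • p = C c * p := smul_eq_C_mul c
  simp only [slAct, LinearMap.add_apply, LinearMap.smul_apply, LinearMap.sub_apply, h,
    LinearMap.id_apply, LinearMap.comp_apply, LinearMap.mulLeft_apply, map_natCast, map_ofNat]

theorem SL2.apply_one_one (A : SL2 F) : A.1 1 1 = - A.1 0 0 := by
  have h : Matrix.trace A.1 = 0 := A.2
  rw [Matrix.trace_fin_two] at h
  linear_combination h

theorem slAct_lie (a : ℕ) (A B : SL2 F) (p : F[X]) :
    slAct a ⁅A, B⁆ p = slAct a A (slAct a B p) - slAct a B (slAct a A p) := by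
  simp only [slAct_apply, LieAlgebra.SpecialLinear.sl_bracket, Matrix.sub_apply, Matrix.mul_apply,
    Fin.sum_univ_two, SL2.apply_one_one, map_add, map_sub, map_mul, map_neg, derivative_mul,
    derivative_C, derivative_natCast, derivative_ofNat, derivative_X, derivative_X_pow]
  have h2 : (C (2 : F) : F[X]) = 2 := map_ofNat C 2
  simp [h2]
  ring

theorem slAct_add_left (a : ℕ) (A B : SL2 F) (p : F[X]) :
    slAct a (A + B) p = slAct a A p + slAct a B p := by
  have h : (A + B).1 = A.1 + B.1 := rfl
  simp only [slAct_apply, h, Matrix.add_apply, map_add]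
  ring

theorem slAct_smul_left (a : ℕ) (c : F) (A : SL2 F) (p : F[X]) :
    slAct a (c • A) p = c • slAct a A p := by
  have h : (c • A).1 = c • A.1 := rfl
  simp only [slAct_apply, h, Matrix.smul_apply, smul_eq_mul, map_mul, smul_eq_C_mul]
  ring

theorem slAct_monomial (a : ℕ) (A : SL2 F) (s : ℕ) (c : F) :
    slAct a A (monomial s c) = monomial (s - 1) (A.1 0 1 * s * c)
      + monomial s (A.1 0 0 * (a - 2 * s) * c) + monomial (s + 1) (A.1 1 0 * (a - s) * c) := by
  have h2 : (C (2 : F) : F[X]) = 2 := map_ofNat C 2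
  rw [slAct_apply, derivative_monomial]
  rcases s with _ | s
  · simp [← C_mul_X_pow_eq_monomial]
    ring
  · simp [← C_mul_X_pow_eq_monomial, h2]
    ring

theorem irr_induction {a : ℕ} {P : F[X] → Prop} (hadd : ∀ p q, P p → P q → P (p + q))
    (hmon : ∀ s c, s ≤ a → P (monomial s c)) {p : F[X]} (hp : p ∈ irr F a) : P p := by
  have h0 : P 0 := by simpa using hmon 0 0 (Nat.zero_le a)
  have hd : p.natDegree < a + 1 := by
    have := natDegree_le_of_degree_le (mem_degreeLE.1 hp)
    omega
  rw [p.as_sum_range' (a + 1) hd]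
  have key : ∀ k ≤ a + 1, P (∑ i ∈ Finset.range k, monomial i (p.coeff i)) := by
    intro k
    induction k with
    | zero => intro _; simpa using h0
    | succ k ih =>
      intro hk
      rw [Finset.sum_range_succ]
      exact hadd _ _ (ih (by omega)) (hmon _ _ (by omega))
  exact key _ le_rfl

theorem monomial_mem_irr {a s : ℕ} (c : F) (h : s ≤ a ∨ c = 0) : monomial s c ∈ irr F a := by
  rcases h with h | rfl
  · exact mem_degreeLE.2 ((degree_monomial_le s c).trans (by exact_mod_cast h))
  · simp

theorem slAct_mem (a : ℕ) (A : SL2 F) {p : F[X]} (hp : p ∈ irr F a) : slAct a A p ∈ irr F a := by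
  refine irr_induction (P := fun p => slAct a A p ∈ irr F a) ?_ ?_ hp
  · intro p q hp hq
    rw [map_add]
    exact add_mem hp hq
  · intro s c hs
    rw [slAct_monomial]
    refine add_mem (add_mem (monomial_mem_irr _ (Or.inl (by omega)))
      (monomial_mem_irr _ (Or.inl hs))) (monomial_mem_irr _ ?_)
    rcases hs.eq_or_lt with rfl | h
    · right; simp
    · left; omega

/-- The falling factorial `x (x - 1) ⋯ (x - k + 1)`. -/
def fall (x : F) (k : ℕ) : F := (descPochhammer F k).eval x

theorem fall_zero (x : F) : fall x 0 = 1 := by simp [fall]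
theorem fall_succ (x : F) (k : ℕ) : fall x (k + 1) = fall x k * (x - k) := descPochhammer_succ_eval k x
theorem fall_add (x : F) (k l : ℕ) : fall x (k + l) = fall x k * fall (x - k) l := by
  induction l with
  | zero => simp [fall_zero]
  | succ l ih =>
    rw [← add_assoc, fall_succ, ih, fall_succ]
    push_cast
    ring
theorem fall_succ_left (x : F) (k : ℕ) : fall x (k + 1) = x * fall (x - 1) k := by
  rw [add_comm, fall_add, fall_succ, fall_zero]; simp
theorem fall_one_add (x : F) (k : ℕ) : fall (x + 1) (k + 1) = fall x (k + 1) + (k + 1) * fall x k := by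
  rw [fall_succ_left, fall_succ]; ring_nf
theorem fall_self (k : ℕ) : fall (k : F) k = (k.factorial : F) := by
  simp [fall, descPochhammer_eval_eq_descFactorial, Nat.descFactorial_self]
theorem fall_of_lt {j k : ℕ} (h : j < k) : fall (j : F) k = 0 := by
  simp [fall, descPochhammer_eval_eq_descFactorial, Nat.descFactorial_eq_zero_iff_lt.2 h]

/-- The sum `∑ₗ (-1)^l (r choose l) (x)_{r-l} (y)_l (u)_l (w)_{r-l}` of products of falling factorials. -/
def tvSum (r : ℕ) (x y u w : F) : F :=
  ∑ l ∈ Finset.range (r + 1), (-1) ^ l * (r.choose l : F) *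
    (fall x (r - l) * fall y l) * (fall u l * fall w (r - l))

theorem tvSum_raise (r : ℕ) (x y u w : F) :
    (y + w - r) * tvSum r x y u w
      = y * tvSum r (x + 1) (y - 1) u w + w * tvSum r x y (u + 1) (w - 1) := by
  have e1 (l : ℕ) : y * fall (y - 1) l = fall y l * (y - l) := by rw [← fall_succ_left, fall_succ]
  have e2 (l : ℕ) : w * fall (w - 1) l = fall w l * (w - l) := by rw [← fall_succ_left, fall_succ]
  have e3 (z : F) (k : ℕ) : fall (z + 1) k = fall z k + k * fall z (k - 1) := by
    rcases k with _ | k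
    · simp [fall_zero]
    · rw [fall_one_add]; simp
  let G : ℕ → F := fun l => (-1) ^ l * (r.choose l : F) * l * fall x (r - l) * fall y l *
    fall u (l - 1) * fall w (r - l + 1)
  have hG : ∀ l ∈ Finset.range (r + 1),
      y * ((-1) ^ l * (r.choose l : F) * (fall (x + 1) (r - l) * fall (y - 1) l) *
        (fall u l * fall w (r - l))) + w * ((-1) ^ l * (r.choose l : F) *
        (fall x (r - l) * fall y l) * (fall (u + 1) l * fall (w - 1) (r - l)))
      = (y + w - r) * ((-1) ^ l * (r.choose l : F) * (fall x (r - l) * fall y l) *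
        (fall u l * fall w (r - l))) + (G l - G (l + 1)) := by
    intro l hl
    have hl : l ≤ r := by simpa [Nat.lt_succ_iff] using hl
    have hc : ((r - l : ℕ) : F) = r - l := by push_cast [hl]; ring
    have hch : (r.choose (l + 1) : F) * (l + 1) = r.choose l * ((r - l : ℕ) : F) := by
      have h := congrArg (fun z : ℕ => (z : F)) (Nat.choose_succ_right_eq r l)
      simpa only [Nat.cast_mul, Nat.cast_add, Nat.cast_one] using h
    have hG1 : G (l + 1) = - ((-1) ^ l * (r.choose l : F) * ((r - l : ℕ) : F)) *
        fall x (r - l - 1) * fall y (l + 1) * fall u l * fall w (r - l) := by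
      rcases hl.eq_or_lt with rfl | h
      · simp [G]
      · have h1 : r - (l + 1) = r - l - 1 := by omega
        have h2 : r - l - 1 + 1 = r - l := by omega
        simp only [G, h1, h2, Nat.add_sub_cancel]
        push_cast
        linear_combination (-(-1) ^ l * fall x (r - l - 1) * fall y (l + 1) * fall u l *
          fall w (r - l)) * hch
    rw [hG1]
    simp only [G]
    rw [e3 x, e3 u, fall_succ w, fall_succ y]
    have a1 := e1 l
    have a2 := e2 (r - l)
    rw [hc] at a2 ⊢
    linear_combination ((-1) ^ l * (r.choose l : F) *
      (fall x (r - l) + (r - l) * fall x (r - l - 1)) * (fall u l * fall w (r - l))) * a1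
      + ((-1) ^ l * (r.choose l : F) * (fall x (r - l) * fall y l) *
        (fall u l + l * fall u (l - 1))) * a2
  unfold tvSum
  rw [Finset.mul_sum, Finset.mul_sum, Finset.mul_sum, ← Finset.sum_add_distrib,
    Finset.sum_congr rfl hG, Finset.sum_add_distrib, Finset.sum_range_sub']
  simp [G]

theorem tvSum_swap (r : ℕ) (x y u w : F) : tvSum r y x w u = (-1) ^ r * tvSum r x y u w := by
  unfold tvSum
  rw [← Finset.sum_range_reflect, Finset.mul_sum]
  refine Finset.sum_congr rfl fun l hl => ?_
  have hl : l ≤ r := by simpa [Nat.lt_succ_iff] using hl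
  have h1 : r + 1 - 1 - l = r - l := by omega
  have h2 : r - (r - l) = l := by omega
  rw [h1, h2, Nat.choose_symm hl]
  have h3 : ((-1 : F)) ^ (r - l) = (-1) ^ r * (-1) ^ l := by
    obtain ⟨k, rfl⟩ := Nat.exists_eq_add_of_le hl
    rw [Nat.add_sub_cancel_left, pow_add, mul_right_comm, ← mul_pow]; simp
  rw [h3]; ring

theorem tvSum_lower (r : ℕ) (x y u w : F) :
    (x + u - r) * tvSum r x y u w
      = x * tvSum r (x - 1) (y + 1) u w + u * tvSum r x y (u - 1) (w + 1) := by
  have h := tvSum_raise r y x w u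
  rw [tvSum_swap r x y u w, tvSum_swap r (x - 1) (y + 1) u w, tvSum_swap r x y (u - 1) (w + 1)] at h
  have h1 : ((-1 : F) ^ r) ≠ 0 := by simp
  apply mul_left_cancel₀ h1
  linear_combination h

/-- The (rationally normalized) Clebsch-Gordan coefficient with which `X^s ⊗ X^j` in `V(m) ⊗ V(b)` is
mapped to the multiple of `X^(s+j-r)` in `V(m + b - 2r)`. -/
def tvCoeff (F : Type*) [Field F] (m b r s j : ℕ) : F :=
  tvSum r ((m : F) - s) s ((b : F) - j) j

/-- The `r`-th transvectant `V(m) ⊗ V(b) → V(m + b - 2r)`, the `sl(2)`-equivariant projection, which is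
unique up to a scalar; see `transvectant_mem` and `transvectant_equivariant`. -/
def transvectant (m b r : ℕ) : F[X] →ₗ[F] F[X] →ₗ[F] F[X] :=
  lsum fun s => LinearMap.toSpanSingleton F _
    (lsum fun j => tvCoeff F m b r s j • monomial (s + j - r))

theorem transvectant_monomial (m b r s j : ℕ) (c d : F) :
    transvectant m b r (monomial s c) (monomial j d) = monomial (s + j - r) (tvCoeff F m b r s j * c * d) := by
  simp [transvectant, smul_monomial]
  ring_nf


theorem tvCoeff_of_lt {m b r s j : ℕ} (h : s + j < r) : tvCoeff F m b r s j = 0 := by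
  rw [tvCoeff, tvSum]
  refine Finset.sum_eq_zero fun l hl => ?_
  by_cases h1 : s < l
  · simp [fall_of_lt h1]
  · simp [fall_of_lt (F := F) (show j < r - l by omega)]

theorem tvCoeff_of_lt' {m b r s j : ℕ} (hs : s ≤ m) (hj : j ≤ b) (h : m + b < s + j + r) :
    tvCoeff F m b r s j = 0 := by
  rw [tvCoeff, tvSum]
  refine Finset.sum_eq_zero fun l hl => ?_
  rw [← Nat.cast_sub hs, ← Nat.cast_sub hj]
  by_cases h1 : b - j < l
  · simp [fall_of_lt h1]
  · simp [fall_of_lt (F := F) (show m - s < r - l by omega)]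

theorem transvectant_mem {m b r a : ℕ} (h : a + 2 * r = m + b) {p q : F[X]} (hp : p ∈ irr F m)
    (hq : q ∈ irr F b) : transvectant m b r p q ∈ irr F a := by
  refine irr_induction (P := fun p => transvectant m b r p q ∈ irr F a) ?_ ?_ hp
  · intro p p' hp hp'
    rw [map_add]
    exact add_mem hp hp'
  · intro s c hs
    refine irr_induction (P := fun q => transvectant m b r (monomial s c) q ∈ irr F a) ?_ ?_ hq
    · intro p p' hp hp'
      rw [map_add]
      exact add_mem hp hp'
    · intro j d hj
      rw [transvectant_monomial]
      apply monomial_mem_irr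
      by_cases hh : m + b < s + j + r
      · right
        rw [tvCoeff_of_lt' hs hj hh]; simp
      · left; omega

theorem tvCoeff_raise (m b r s j : ℕ) : ((s : F) + j - r) * tvCoeff F m b r s j
    = s * tvCoeff F m b r (s - 1) j + j * tvCoeff F m b r s (j - 1) := by
  have e := tvSum_raise r ((m : F) - s) s ((b : F) - j) j
  rw [tvCoeff, e]
  congr 1
  · rcases s with _ | s
    · simp
    · rw [tvCoeff]
      push_cast
      simp only [add_sub_cancel_right]
      ring_nf
  · rcases j with _ | j
    · simp
    · rw [tvCoeff]
      push_cast
      simp only [add_sub_cancel_right]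
      ring_nf

theorem tvCoeff_lower (m b r s j : ℕ) : ((m : F) - s + (b - j) - r) * tvCoeff F m b r s j
    = (m - s) * tvCoeff F m b r (s + 1) j + (b - j) * tvCoeff F m b r s (j + 1) := by
  have e := tvSum_lower r ((m : F) - s) s ((b : F) - j) j
  rw [tvCoeff, e, tvCoeff, tvCoeff]
  push_cast
  simp only [sub_sub]

theorem transvectant_equivariant {m b r a : ℕ} (h : a + 2 * r = m + b) (A : SL2 F) (p q : F[X]) :
    slAct a A (transvectant m b r p q) = transvectant m b r (slAct m A p) q + transvectant m b r p (slAct b A q) := by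
  induction p using Polynomial.induction_on' with
  | add p p' hp hp' =>
    simp only [map_add, LinearMap.add_apply, hp, hp']
    abel
  | monomial s c =>
    induction q using Polynomial.induction_on' with
    | add q q' hq hq' =>
      simp only [map_add, hq, hq']
      abel
    | monomial j d =>
      have hF : (a : F) = m + b - 2 * r := by
        have := congrArg (fun z : ℕ => (z : F)) h
        push_cast at this
        linear_combination this
      have r1 : (monomial (s + j - r - 1) ((A.1 0 1 * (s + j - r : ℕ)
            * (tvCoeff F m b r s j * c * d)) : F))
          = monomial (s - 1 + j - r) (tvCoeff F m b r (s - 1) j * (A.1 0 1 * s * c) * d)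
            + monomial (s + (j - 1) - r) (tvCoeff F m b r s (j - 1) * c * (A.1 0 1 * j * d)) := by
        have e := tvCoeff_raise (F := F) m b r s j
        by_cases hr : s + j ≤ r
        · have z1 : (s : F) * tvCoeff F m b r (s - 1) j = 0 := by
            rcases s with _ | s
            · simp
            · rw [tvCoeff_of_lt (by omega), mul_zero]
          have z2 : (j : F) * tvCoeff F m b r s (j - 1) = 0 := by
            rcases j with _ | j
            · simp
            · rw [tvCoeff_of_lt (by omega), mul_zero]
          rw [Nat.sub_eq_zero_of_le hr,
            show tvCoeff F m b r (s - 1) j * (A.1 0 1 * s * c) * d = 0 by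
              linear_combination (A.1 0 1 * c * d) * z1,
            show tvCoeff F m b r s (j - 1) * c * (A.1 0 1 * j * d) = 0 by
              linear_combination (A.1 0 1 * c * d) * z2]
          simp
        · have m1 : monomial (s - 1 + j - r) (tvCoeff F m b r (s - 1) j * (A.1 0 1 * s * c) * d)
              = monomial (s + j - r - 1)
                (tvCoeff F m b r (s - 1) j * (A.1 0 1 * s * c) * d) := by
            rcases s with _ | s
            · simp
            · rw [show s + 1 - 1 + j - r = s + 1 + j - r - 1 by omega]
          have m2 : monomial (s + (j - 1) - r) (tvCoeff F m b r s (j - 1) * c * (A.1 0 1 * j * d))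
              = monomial (s + j - r - 1)
                (tvCoeff F m b r s (j - 1) * c * (A.1 0 1 * j * d)) := by
            rcases j with _ | j
            · simp
            · rw [show s + (j + 1 - 1) - r = s + (j + 1) - r - 1 by omega]
          rw [m1, m2, ← map_add, Nat.cast_sub (by omega)]
          push_cast
          congr 1
          linear_combination (A.1 0 1 * c * d) * e
      have r2 : (monomial (s + j - r + 1) (A.1 1 0 * (a - (s + j - r : ℕ))
            * (tvCoeff F m b r s j * c * d)))
          = monomial (s + 1 + j - r) (tvCoeff F m b r (s + 1) j * (A.1 1 0 * (m - s) * c) * d)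
            + monomial (s + (j + 1) - r)
              (tvCoeff F m b r s (j + 1) * c * (A.1 1 0 * (b - j) * d)) := by
        have e := tvCoeff_lower (F := F) m b r s j
        rw [show s + 1 + j - r = s + (j + 1) - r by omega, ← map_add]
        by_cases hr : s + j < r
        · rw [tvCoeff_of_lt hr] at e ⊢
          rw [show tvCoeff F m b r (s + 1) j * (A.1 1 0 * (m - s) * c) * d
              + tvCoeff F m b r s (j + 1) * c * (A.1 1 0 * (b - j) * d) = 0 by
            linear_combination (-(A.1 1 0 * c * d)) * e]
          simp
        · rw [show s + (j + 1) - r = s + j - r + 1 by omega, Nat.cast_sub (by omega), hF]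
          push_cast
          congr 1
          linear_combination (A.1 1 0 * c * d) * e
      have r3 : (monomial (s + j - r) (A.1 0 0 * (a - 2 * (s + j - r : ℕ))
            * (tvCoeff F m b r s j * c * d)))
          = monomial (s + j - r) (tvCoeff F m b r s j * (A.1 0 0 * (m - 2 * s) * c) * d)
            + monomial (s + j - r) (tvCoeff F m b r s j * c * (A.1 0 0 * (b - 2 * j) * d)) := by
        rw [← map_add]
        by_cases hr : s + j < r
        · simp [tvCoeff_of_lt hr]
        · rw [Nat.cast_sub (by omega), hF]
          push_cast
          congr 1
          ring
      rw [transvectant_monomial, slAct_monomial, slAct_monomial, slAct_monomial, r1, r2, r3]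
      simp only [map_add, LinearMap.add_apply, transvectant_monomial]
      abel

theorem tvCoeff_comm (m b r s j : ℕ) : tvCoeff F b m r j s = (-1) ^ r * tvCoeff F m b r s j := by
  unfold tvCoeff tvSum
  rw [← Finset.sum_range_reflect, Finset.mul_sum]
  refine Finset.sum_congr rfl fun l hl => ?_
  have hl : l ≤ r := by simpa [Nat.lt_succ_iff] using hl
  have h1 : r + 1 - 1 - l = r - l := by omega
  have h2 : r - (r - l) = l := by omega
  rw [h1, h2, Nat.choose_symm hl]
  have h3 : ((-1 : F)) ^ (r - l) = (-1) ^ r * (-1) ^ l := by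
    obtain ⟨k, rfl⟩ := Nat.exists_eq_add_of_le hl
    rw [Nat.add_sub_cancel_left, pow_add, mul_right_comm, ← mul_pow]; simp
  rw [h3]; ring

theorem transvectant_comm (m b r : ℕ) (p q : F[X]) :
    transvectant b m r q p = (-1 : F) ^ r • transvectant m b r p q := by
  induction p using Polynomial.induction_on' with
  | add p p' hp hp' => simp only [map_add, LinearMap.add_apply, hp, hp', smul_add]
  | monomial s c =>
    induction q using Polynomial.induction_on' with
    | add q q' hq hq' => simp only [map_add, LinearMap.add_apply, hq, hq', smul_add]
    | monomial j d =>
      rw [transvectant_monomial, transvectant_monomial, tvCoeff_comm, smul_monomial, add_comm j s, smul_eq_mul]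
      congr 1
      ring

/-- The invariant skew form on `V(2n-1)`: the projection `V(2n-1) ⊗ V(2n-1) → V(0)`. -/
def heisForm (n : ℕ) (p q : F[X]) : F :=
  (transvectant (2 * n - 1) (2 * n - 1) (2 * n - 1) p q).coeff 0

theorem heisForm_add_left (n : ℕ) (p p' q : F[X]) : heisForm n (p + p') q = heisForm n p q + heisForm n p' q := by
  simp [heisForm]

theorem heisForm_add_right (n : ℕ) (p q q' : F[X]) : heisForm n p (q + q') = heisForm n p q + heisForm n p q' := by
  simp [heisForm]

theorem heisForm_smul_right (n : ℕ) (c : F) (p q : F[X]) : heisForm n p (c • q) = c * heisForm n p q := by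
  simp [heisForm]

theorem heisForm_skew (n : ℕ) [NeZero n] (p q : F[X]) : heisForm n q p = - heisForm n p q := by
  have hn := NeZero.pos n
  have ho : Odd (2 * n - 1) := ⟨n - 1, by omega⟩
  rw [heisForm, transvectant_comm, ho.neg_one_pow]
  simp [heisForm]

theorem heisForm_self (n : ℕ) [NeZero n] [CharZero F] (p : F[X]) : heisForm n p p = 0 := by
  have h := heisForm_skew n p p
  have h2 : (2 : F) * heisForm n p p = 0 := by linear_combination h
  simpa using h2

theorem heisForm_invariant (n : ℕ) (A : SL2 F) {p q : F[X]} (hp : p ∈ irr F (2 * n - 1))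
    (hq : q ∈ irr F (2 * n - 1)) :
    heisForm n (slAct (2 * n - 1) A p) q + heisForm n p (slAct (2 * n - 1) A q) = 0 := by
  have h : 0 + 2 * (2 * n - 1) = (2 * n - 1) + (2 * n - 1) := by omega
  have h1 := transvectant_mem h hp hq
  have h2 := congrArg (fun p => p.coeff 0) (transvectant_equivariant h A p q)
  have h3 : slAct 0 A (transvectant (2 * n - 1) (2 * n - 1) (2 * n - 1) p q) = 0 := by
    obtain ⟨c, hc⟩ : ∃ c, transvectant (2 * n - 1) (2 * n - 1) (2 * n - 1) p q = C c :=
      ⟨_, eq_C_of_degree_le_zero (by simpa using mem_degreeLE.1 h1)⟩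
    rw [hc, slAct_apply]
    simp
  simp only [h3, coeff_zero, coeff_add] at h2
  exact h2.symm

/-- The Heisenberg Lie algebra `h_n = V(2n-1) ⊕ F z`; the pair `(p, c)` stands for `p + c z`, and
`[p, q] = heisForm p q • z`. -/
def Heisenberg (F : Type*) [Field F] (n : ℕ) : Type _ := irr F (2 * n - 1) × F

namespace Heisenberg

instance (n : ℕ) : AddCommGroup (Heisenberg F n) := inferInstanceAs (AddCommGroup (_ × _))
instance (n : ℕ) : Module F (Heisenberg F n) := inferInstanceAs (Module F (_ × _))

instance (n : ℕ) : Bracket (Heisenberg F n) (Heisenberg F n) :=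
  ⟨fun x y => ((0 : irr F (2 * n - 1)), heisForm n x.1.1 y.1.1)⟩

theorem lie_def {n : ℕ} (x y : Heisenberg F n) :
    ⁅x, y⁆ = ((0 : irr F (2 * n - 1)), heisForm n x.1.1 y.1.1) := rfl

instance (n : ℕ) [NeZero n] [CharZero F] : LieRing (Heisenberg F n) where
  add_lie x y z := Prod.ext (add_zero (0 : irr F (2 * n - 1))).symm (heisForm_add_left n _ _ _)
  lie_add x y z := Prod.ext (add_zero (0 : irr F (2 * n - 1))).symm (heisForm_add_right n _ _ _)
  lie_self x := Prod.ext rfl (heisForm_self n _)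
  leibniz_lie x y z := by
    refine Prod.ext (add_zero (0 : irr F (2 * n - 1))).symm ?_
    change heisForm n _ 0 = heisForm n 0 _ + heisForm n _ 0
    simp [heisForm]

instance (n : ℕ) [NeZero n] [CharZero F] : LieAlgebra F (Heisenberg F n) where
  lie_smul c x y := Prod.ext (smul_zero (A := irr F (2 * n - 1)) c).symm (heisForm_smul_right n c _ _)

/-- `sl(2)` acts on `h_n = V(2n-1) ⊕ V(0)` by derivations. -/
def slDer (n : ℕ) [NeZero n] [CharZero F] :
    SL2 F →ₗ⁅F⁆ LieDerivation F (Heisenberg F n) (Heisenberg F n) where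
  toFun A :=
    { toFun := fun x => (⟨slAct (2 * n - 1) A x.1.1, slAct_mem _ A x.1.2⟩, 0)
      map_add' := fun x y => Prod.ext (Subtype.ext (map_add (slAct _ A) _ _)) (add_zero (0 : F)).symm
      map_smul' := fun c x => Prod.ext (Subtype.ext (map_smul (slAct _ A) _ _)) (mul_zero c).symm
      leibniz' := fun x y => by
        refine Prod.ext (Subtype.ext ?_) ?_
        · change slAct _ A 0 = 0 - 0
          simp
        · change 0 = heisForm n x.1.1 (slAct _ A y.1.1) - heisForm n y.1.1 (slAct _ A x.1.1)
          rw [heisForm_skew n (slAct _ A x.1.1)]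
          linear_combination - heisForm_invariant n A x.1.2 y.1.2 }
  map_add' A B := LieDerivation.ext fun x =>
    Prod.ext (Subtype.ext (slAct_add_left _ A B _)) (add_zero (0 : F)).symm
  map_smul' c A := LieDerivation.ext fun x =>
    Prod.ext (Subtype.ext (slAct_smul_left _ c A _)) (mul_zero c).symm
  map_lie' {A B} := LieDerivation.ext fun x => by
    rw [LieDerivation.lie_apply]
    exact Prod.ext (Subtype.ext (slAct_lie _ A B _)) (sub_zero (0 : F)).symm

end Heisenberg

/-- The Galilean Lie algebra `sl(2) ⋉ h_n`. -/
abbrev GalileanAlgebra (F : Type*) [Field F] [CharZero F] (n : ℕ) [NeZero n] : Type _ :=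
  LieAlgebra.SemiDirectSum (Heisenberg F n) (SL2 F) (Heisenberg.slDer n)


/-- The data of an `sl(2)`-module `V(a_0) ⊕ ⋯ ⊕ V(a_len)`, `a_i = wt i`, on which `V(2n-1) ⊆ h_n` maps
`V(a_{i+1})` to `V(a_i)` by the projection `V(2n-1) ⊗ V(a_{i+1}) → V(a_i)` (and `V(a_0)` to `0`), and
`z` maps `V(a_{i+2})` to `V(a_i)` by the scalar `zeta i`. The last four fields say that this is
an action of `sl(2) ⋉ h_n`. -/
structure Ladder (F : Type*) [Field F] (n : ℕ) where
  /-- The number of layers minus one. -/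
  len : ℕ
  /-- The highest weights `a_0, …, a_len`; the values beyond `len` are irrelevant. -/
  wt : ℕ → ℕ
  /-- The scalars by which `z` acts. -/
  zeta : ℕ → F
  weight_eq : ∀ i < len,
    wt i + 2 * ((2 * n - 1 + wt (i + 1) - wt i) / 2) = 2 * n - 1 + wt (i + 1)
  zeta_wt : ∀ i, i + 2 ≤ len → zeta i ≠ 0 → wt (i + 2) = wt i
  zeta_long : 3 ≤ len → ∀ i, zeta i = 0
  bracket : ∀ i, i + 2 ≤ len → ∀ p ∈ irr F (2 * n - 1), ∀ q ∈ irr F (2 * n - 1),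
    ∀ x ∈ irr F (wt (i + 2)),
      transvectant (2 * n - 1) (wt (i + 1)) ((2 * n - 1 + wt (i + 1) - wt i) / 2) p
          (transvectant (2 * n - 1) (wt (i + 2)) ((2 * n - 1 + wt (i + 2) - wt (i + 1)) / 2) q x)
        - transvectant (2 * n - 1) (wt (i + 1)) ((2 * n - 1 + wt (i + 1) - wt i) / 2) q
          (transvectant (2 * n - 1) (wt (i + 2)) ((2 * n - 1 + wt (i + 2) - wt (i + 1)) / 2) p x)
      = (heisForm n p q * zeta i) • x

namespace Ladder

/-- Sequences `(x_i)` with `x_i ∈ V(a_i)` for `i ≤ len` and `x_i = 0` for `i > len`. -/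
def carrier {n : ℕ} (D : Ladder F n) : Submodule F (ℕ → F[X]) where
  carrier := {x | ∀ i, (i ≤ D.len → x i ∈ irr F (D.wt i)) ∧ (D.len < i → x i = 0)}
  add_mem' {x y} hx hy i := by
    refine ⟨fun h => add_mem ((hx i).1 h) ((hy i).1 h), fun h => ?_⟩
    simp [(hx i).2 h, (hy i).2 h]
  zero_mem' i := ⟨fun _ => zero_mem _, fun _ => rfl⟩
  smul_mem' c x hx i := by
    refine ⟨fun h => Submodule.smul_mem _ c ((hx i).1 h), fun h => ?_⟩
    simp [(hx i).2 h]

/-- The `sl(2) ⋉ h_n`-module `V(a_0) ⊕ ⋯ ⊕ V(a_len)` of a ladder. -/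
def Mod {n : ℕ} (D : Ladder F n) : Type _ := D.carrier

variable {n : ℕ} [NeZero n] [CharZero F] (D : Ladder F n)

instance : AddCommGroup D.Mod := inferInstanceAs (AddCommGroup D.carrier)
instance : Module F D.Mod := inferInstanceAs (Module F D.carrier)

/-- The action of `A + p + c z` with `A ∈ sl(2)`, `p ∈ V(2n-1)`. -/
def act {n : ℕ} [NeZero n] (D : Ladder F n) (g : GalileanAlgebra F n) (x : ℕ → F[X]) (i : ℕ) : F[X] :=
  slAct (D.wt i) g.right (x i)
    + transvectant (2 * n - 1) (D.wt (i + 1)) ((2 * n - 1 + D.wt (i + 1) - D.wt i) / 2)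
        g.left.1.1 (x (i + 1))
    + (g.left.2 * D.zeta i) • x (i + 2)

theorem act_mem (g : GalileanAlgebra F n) {x : ℕ → F[X]} (hx : x ∈ D.carrier) :
    D.act g x ∈ D.carrier := by
  intro i
  refine ⟨fun h => ?_, fun h => ?_⟩
  · refine add_mem (add_mem (slAct_mem _ _ ((hx i).1 h)) ?_) ?_
    · rcases h.eq_or_lt with h | h
      · rw [(hx (i + 1)).2 (by omega), map_zero]
        exact zero_mem _
      · exact transvectant_mem (D.weight_eq i h) g.left.1.2 ((hx (i + 1)).1 h)
    · by_cases h2 : i + 2 ≤ D.len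
      · by_cases hz : D.zeta i = 0
        · rw [hz, mul_zero, zero_smul]
          exact zero_mem _
        · rw [← D.zeta_wt i h2 hz]
          exact Submodule.smul_mem _ _ ((hx (i + 2)).1 h2)
      · rw [(hx (i + 2)).2 (by omega), smul_zero]
        exact zero_mem _
  · simp [act, (hx i).2 h, (hx (i + 1)).2 (by omega), (hx (i + 2)).2 (by omega)]

instance : Bracket (GalileanAlgebra F n) D.Mod := ⟨fun g x => ⟨D.act g x.1, D.act_mem g x.2⟩⟩

theorem act_lie (g h : GalileanAlgebra F n) {x : ℕ → F[X]} (hx : x ∈ D.carrier) (i : ℕ) :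
    D.act ⁅g, h⁆ x i = D.act g (D.act h x) i - D.act h (D.act g x) i := by
  have hl : ⁅g, h⁆.left.1.1 = slAct (2 * n - 1) g.right h.left.1.1
      - slAct (2 * n - 1) h.right g.left.1.1 := by
    change (0 : F[X]) + slAct (2 * n - 1) g.right h.left.1.1
      - slAct (2 * n - 1) h.right g.left.1.1 = _
    rw [zero_add]
  have hz : ⁅g, h⁆.left.2 = heisForm n g.left.1.1 h.left.1.1 := by
    change heisForm n g.left.1.1 h.left.1.1 + 0 - 0 = _
    rw [add_zero, sub_zero]
  have hr : ⁅g, h⁆.right = ⁅g.right, h.right⁆ := rfl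
  simp only [act, hl, hz, hr, slAct_lie, map_add, map_sub, map_smul, LinearMap.sub_apply, smul_add]
  by_cases h0 : D.len < i
  · simp [(hx i).2 h0, (hx (i + 1)).2 (by omega), (hx (i + 2)).2 (by omega),
      (hx (i + 3)).2 (by omega), (hx (i + 4)).2 (by omega)]
  by_cases h1 : D.len < i + 1
  · simp [(hx (i + 1)).2 (by omega), (hx (i + 2)).2 (by omega),
      (hx (i + 3)).2 (by omega), (hx (i + 4)).2 (by omega)]
  have hw := D.weight_eq i (by omega)
  rw [transvectant_equivariant hw, transvectant_equivariant hw]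
  by_cases h2 : D.len < i + 2
  · simp [(hx (i + 2)).2 (by omega), (hx (i + 3)).2 (by omega), (hx (i + 4)).2 (by omega)]
    abel
  have hb := D.bracket i (by omega) _ g.left.1.2 _ h.left.1.2 _ ((hx (i + 2)).1 (by omega))
  rw [← hb]
  by_cases h3 : D.len < i + 3
  · have e (A : SL2 F) : D.zeta i • slAct (D.wt i) A (x (i + 2))
        = D.zeta i • slAct (D.wt (i + 2)) A (x (i + 2)) := by
      by_cases hz : D.zeta i = 0
      · simp [hz]
      · rw [D.zeta_wt i (by omega) hz]
    simp only [(hx (i + 3)).2 (by omega), (hx (i + 4)).2 (by omega), map_zero, smul_zero, add_zero,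
      mul_smul, e]
    abel
  · simp only [D.zeta_long (by omega), mul_zero, zero_smul, add_zero]
    abel

instance : LieRingModule (GalileanAlgebra F n) D.Mod where
  add_lie g h x := Subtype.ext (funext fun i => by
    change D.act (g + h) x.1 i = D.act g x.1 i + D.act h x.1 i
    have hl : (g + h).left.1.1 = g.left.1.1 + h.left.1.1 := rfl
    have hz : (g + h).left.2 = g.left.2 + h.left.2 := rfl
    have hr : (g + h).right = g.right + h.right := rfl
    simp only [act, hl, hz, hr, slAct_add_left, map_add, LinearMap.add_apply, add_mul, add_smul]
    abel)
  lie_add g x y := Subtype.ext (funext fun i => by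
    change D.act g (x.1 + y.1) i = D.act g x.1 i + D.act g y.1 i
    simp only [act, Pi.add_apply, map_add, smul_add]
    abel)
  leibniz_lie g h x := Subtype.ext (funext fun i => by
    change D.act g (D.act h x.1) i = D.act ⁅g, h⁆ x.1 i + D.act h (D.act g x.1) i
    rw [D.act_lie g h x.2]
    abel)

instance : LieModule F (GalileanAlgebra F n) D.Mod where
  smul_lie c g x := Subtype.ext (funext fun i => by
    change D.act (c • g) x.1 i = c • D.act g x.1 i
    have hl : (c • g).left.1.1 = c • g.left.1.1 := rfl
    have hz : (c • g).left.2 = c * g.left.2 := rfl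
    have hr : (c • g).right = c • g.right := rfl
    simp only [act, hl, hz, hr, slAct_smul_left, map_smul, LinearMap.smul_apply, smul_add,
      mul_smul])
  lie_smul c g x := Subtype.ext (funext fun i => by
    change D.act g (c • x.1) i = c • D.act g x.1 i
    simp only [act, Pi.smul_apply, map_smul, smul_add, smul_comm c])

end Ladder

theorem transvectant_zero (m b : ℕ) (p q : F[X]) : transvectant m b 0 p q = p * q := by
  induction p using Polynomial.induction_on' with
  | add p p' hp hp' => simp only [map_add, LinearMap.add_apply, hp, hp', add_mul]
  | monomial s c =>
    induction q using Polynomial.induction_on' with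
    | add q q' hq hq' => simp only [map_add, hq, hq', mul_add]
    | monomial j d =>
      rw [transvectant_monomial, monomial_mul_monomial]
      simp [tvCoeff, tvSum, fall_zero]

theorem tvCoeff_full {m s : ℕ} (hs : s ≤ m) (b j : ℕ) : tvCoeff F m b m s j
    = (-1) ^ s * (m.factorial : F) * fall ((b : F) - j) s * fall (j : F) (m - s) := by
  unfold tvCoeff tvSum
  rw [Finset.sum_eq_single s]
  · have h : ((m.choose s * s.factorial * (m - s).factorial : ℕ) : F) = (m.factorial : ℕ) := by
      rw [Nat.choose_mul_factorial_mul_factorial hs]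
    push_cast at h
    rw [← Nat.cast_sub hs, fall_self, fall_self, ← h]
    ring
  · intro l hl hne
    rw [← Nat.cast_sub hs]
    have hl : l < m + 1 := by simpa using hl
    rcases lt_or_gt_of_ne hne with h | h
    · rw [fall_of_lt (F := F) (show m - s < m - l by omega)]; ring
    · rw [fall_of_lt (F := F) h]; ring
  · intro h
    exact absurd (Finset.mem_range.2 (by omega)) h

theorem bracket_of_monomial {m b b' r r' : ℕ} {n : ℕ} {z : F}
    (h : ∀ s ≤ m, ∀ k ≤ m, ∀ j ≤ b, ∀ c d e : F,
      transvectant m b' r (monomial s c) (transvectant m b r' (monomial k d) (monomial j e))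
        - transvectant m b' r (monomial k d) (transvectant m b r' (monomial s c) (monomial j e))
      = (heisForm n (monomial s c) (monomial k d) * z) • monomial j e)
    {p q x : F[X]} (hp : p ∈ irr F m) (hq : q ∈ irr F m) (hx : x ∈ irr F b) :
    transvectant m b' r p (transvectant m b r' q x) - transvectant m b' r q (transvectant m b r' p x)
      = (heisForm n p q * z) • x := by
  refine irr_induction (P := fun p => transvectant m b' r p (transvectant m b r' q x)
    - transvectant m b' r q (transvectant m b r' p x) = (heisForm n p q * z) • x) ?_ ?_ hp
  · intro p p' h1 h2
    simp only [map_add, LinearMap.add_apply, heisForm_add_left, add_mul, add_smul, ← h1, ← h2]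
    abel
  intro s c hs
  refine irr_induction (P := fun q => transvectant m b' r (monomial s c) (transvectant m b r' q x)
    - transvectant m b' r q (transvectant m b r' (monomial s c) x) = (heisForm n (monomial s c) q * z) • x) ?_ ?_ hq
  · intro p p' h1 h2
    simp only [map_add, LinearMap.add_apply, heisForm_add_right, add_mul, add_smul, ← h1, ← h2]
    abel
  intro k d hk
  refine irr_induction (P := fun x => transvectant m b' r (monomial s c) (transvectant m b r' (monomial k d) x)
    - transvectant m b' r (monomial k d) (transvectant m b r' (monomial s c) x)
      = (heisForm n (monomial s c) (monomial k d) * z) • x) ?_ ?_ hx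
  · intro p p' h1 h2
    simp only [map_add, smul_add, ← h1, ← h2]
    abel
  intro j e hj
  exact h s hs k hk j hj c d e

theorem heisForm_monomial {n s k : ℕ} (hs : s ≤ 2 * n - 1) (c d : F) :
    heisForm n (monomial s c) (monomial k d) = if s + k = 2 * n - 1 then
      (-1) ^ s * ((2 * n - 1).factorial : F) * s.factorial * k.factorial * c * d else 0 := by
  rw [heisForm, transvectant_monomial, coeff_monomial, tvCoeff_full hs]
  split_ifs with h1 h2 h2
  · have e : 2 * n - 1 - s = k := by omega
    have e' : ((2 * n - 1 : ℕ) : F) - k = s := by rw [← h2]; push_cast; ring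
    rw [e, e', fall_self, fall_self]
  · rw [fall_of_lt (show k < 2 * n - 1 - s by omega)]; ring
  · omega
  · rfl

theorem fall_natCast (x k : ℕ) : fall (x : F) k = (x.descFactorial k : ℕ) := by
  simp [fall, descPochhammer_eval_eq_descFactorial]

theorem fall_succ_self (k : ℕ) : fall ((k : F) + 1) k = ((k + 1).factorial : ℕ) := by
  rw [← Nat.cast_succ, fall_natCast, ← Nat.descFactorial_self (k + 1), Nat.descFactorial_succ]
  simp

theorem tvCoeff_full' {b j : ℕ} (hj : j ≤ b) (m s : ℕ) : tvCoeff F m b b s j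
    = (-1) ^ b * ((-1) ^ j * (b.factorial : F) * fall ((m : F) - s) j * fall (s : F) (b - j)) := by
  rw [tvCoeff_comm, tvCoeff_full hj]

theorem tvCoeff_one (m b s j : ℕ) : tvCoeff F m b 1 s j = ((m : F) - s) * j - s * (b - j) := by
  simp [tvCoeff, tvSum, Finset.sum_range_succ, fall_succ, fall_zero]
  ring

theorem even_parity {s k : ℕ} (h : Even (s + k)) : (-1 : F) ^ s = (-1) ^ k := by
  rcases Nat.even_or_odd s with h1 | h1
  · rw [h1.neg_one_pow, ((Nat.even_add.1 h).1 h1).neg_one_pow]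
  · have h2 : Odd k := by
      rw [← Nat.not_even_iff_odd] at h1 ⊢
      exact fun h3 => h1 ((Nat.even_add.1 h).2 h3)
    rw [h1.neg_one_pow, h2.neg_one_pow]

theorem plus_aux {m a : ℕ} (hm : Odd m) (h : m = 1 ∨ a ≤ 1) {s k j : ℕ} (hs : s ≤ m) (hk : k ≤ m)
    (hj : j ≤ a) :
    (-1) ^ s * (m.factorial : F) * fall ((a : F) + m - (k + j)) s * fall ((k : F) + j) (m - s)
      - (-1) ^ k * (m.factorial : F) * fall ((a : F) + m - (s + j)) k * fall ((s : F) + j) (m - k)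
    = if s + k = m then (-1) ^ s * (m.factorial : F) * s.factorial * k.factorial * (a * m + 2)
      else 0 := by
  rcases h with rfl | ha
  · obtain rfl | rfl : s = 0 ∨ s = 1 := by omega
    · obtain rfl | rfl : k = 0 ∨ k = 1 := by omega
      · simp [fall_zero, fall_succ]
      · simp [fall_zero, fall_succ]; ring
    · obtain rfl | rfl : k = 0 ∨ k = 1 := by omega
      · simp [fall_zero, fall_succ]; ring
      · simp [fall_zero, fall_succ]
  have par : ∀ s k : ℕ, Even (s + k) → (-1 : F) ^ s = (-1) ^ k := fun _ _ => even_parity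
  have val : ∀ s ≤ m, ∀ k ≤ m, s + k = m →
      fall ((a : F) + m - (k + j)) s * fall ((k : F) + j) (m - s)
        = s.factorial * k.factorial * (if a = 0 then 1 else if j = 0 then (s + 1 : F) else k + 1) := by
    intro s hs k hk hsk
    have e : (m : F) = s + k := by rw [← hsk]; push_cast; ring
    rw [e, show m - s = k by omega]
    obtain rfl | rfl : a = 0 ∨ a = 1 := by omega
    · obtain rfl : j = 0 := by omega
      simp [fall_self]
    · obtain rfl | rfl : j = 0 ∨ j = 1 := by omega
      · simp only [Nat.cast_one, Nat.cast_zero, add_zero, if_true, one_ne_zero, if_false]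
        rw [show (1 : F) + (s + k) - k = s + 1 by ring, fall_succ_self, fall_self,
          Nat.factorial_succ]
        push_cast; ring
      · simp only [Nat.cast_one, one_ne_zero, if_false]
        rw [show (1 : F) + (s + k) - (k + 1) = s by ring, fall_succ_self, fall_self,
          Nat.factorial_succ]
        push_cast; ring
  split_ifs with hsk
  · have e : (m : F) = s + k := by rw [← hsk]; push_cast; ring
    have v1 := val s hs k hk hsk
    have v2 := val k hk s hs (by omega)
    have p1 : (-1 : F) ^ k = - (-1) ^ s := by
      rw [par k (s + 1) (by rw [← add_assoc, add_comm k s, hsk]; exact hm.add_one), pow_succ]; ring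
    rw [mul_assoc _ (fall _ s), v1, mul_assoc _ (fall _ k), v2, p1]
    obtain rfl | rfl : a = 0 ∨ a = 1 := by omega
    · simp; ring
    · obtain rfl | rfl : j = 0 ∨ j = 1 := by omega
      · simp [e]; ring
      · simp [e]; ring
  · obtain rfl | rfl : a = 0 ∨ a = 1 := by omega
    · obtain rfl : j = 0 := by omega
      have z : ∀ s ≤ m, ∀ k ≤ m, s + k ≠ m →
          fall (((0 : ℕ) : F) + m - (k + (0 : ℕ))) s * fall ((k : F) + (0 : ℕ)) (m - s) = 0 := by
        intro s hs k hk h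
        rw [show ((0 : ℕ) : F) + m - (k + (0 : ℕ)) = ((m - k : ℕ) : F) by
          rw [Nat.cast_sub hk]; push_cast; ring, Nat.cast_zero, add_zero]
        rcases lt_or_gt_of_ne h with h | h
        · rw [fall_of_lt (show k < m - s by omega), mul_zero]
        · rw [fall_of_lt (show m - k < s by omega), zero_mul]
      rw [mul_assoc _ (fall _ s), z s hs k hk hsk, mul_assoc _ (fall _ k), z k hk s hs (by omega)]
      simp
    · obtain rfl | rfl : j = 0 ∨ j = 1 := by omega
      · have z : ∀ s ≤ m, ∀ k ≤ m, s + k ≠ m →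
            fall (((1 : ℕ) : F) + m - (k + (0 : ℕ))) s * fall ((k : F) + (0 : ℕ)) (m - s)
              = if s + k = m + 1 then (s.factorial * k.factorial : F) else 0 := by
          intro s hs k hk h
          rw [show ((1 : ℕ) : F) + m - (k + (0 : ℕ)) = ((m + 1 - k : ℕ) : F) by
            rw [Nat.cast_sub (by omega)]; push_cast; ring, Nat.cast_zero, add_zero]
          split_ifs with h1
          · obtain ⟨k, rfl⟩ : ∃ k', k = k' + 1 := ⟨k - 1, by omega⟩
            rw [show m + 1 - (k + 1) = s by omega, show m - s = k by omega, fall_self,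
              Nat.cast_succ, fall_succ_self]
          · rcases lt_or_gt_of_ne h with h | h
            · rw [fall_of_lt (show k < m - s by omega), mul_zero]
            · rw [fall_of_lt (show m + 1 - k < s by omega), zero_mul]
        rw [mul_assoc _ (fall _ s), z s hs k hk hsk, mul_assoc _ (fall _ k), z k hk s hs (by omega), add_comm k s]
        split_ifs with h1
        · rw [par s k (by rw [h1]; exact hm.add_one)]; ring
        · simp
      · have z : ∀ s ≤ m, ∀ k ≤ m, s + k ≠ m →
            fall (((1 : ℕ) : F) + m - (k + (1 : ℕ))) s * fall ((k : F) + (1 : ℕ)) (m - s)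
              = if s + k + 1 = m then ((s + 1).factorial * (k + 1).factorial : F) else 0 := by
          intro s hs k hk h
          rw [show ((1 : ℕ) : F) + m - (k + (1 : ℕ)) = ((m - k : ℕ) : F) by
            rw [Nat.cast_sub hk]; push_cast; ring, show (k : F) + (1 : ℕ) = ((k + 1 : ℕ) : F) by
            push_cast; ring]
          split_ifs with h1
          · rw [show m - k = s + 1 by omega, show m - s = k + 1 by omega, fall_self,
              Nat.cast_succ, fall_succ_self]
          · rcases lt_or_gt_of_ne h with h | h
            · rw [fall_of_lt (show k + 1 < m - s by omega), mul_zero]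
            · rw [fall_of_lt (show m - k < s by omega), zero_mul]
        rw [mul_assoc _ (fall _ s), z s hs k hk hsk, mul_assoc _ (fall _ k), z k hk s hs (by omega), add_comm k s]
        split_ifs with h1
        · have : Even (s + k) := by
            by_contra h2
            rw [Nat.not_even_iff_odd] at h2
            exact (Nat.not_even_iff_odd.2 hm) (h1 ▸ h2.add_one)
          rw [par s k this]; ring
        · simp

theorem minus_aux_zero {M : ℕ} (hM : Even M) {s k : ℕ} (hs : s ≤ M + 1) (hk : k ≤ M + 1) :
    tvCoeff F (M + 1) M M s (k - 1) * k - tvCoeff F (M + 1) M M k (s - 1) * s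
      = if s + k = M + 1 then (-1) ^ s * ((M + 1).factorial : F) * s.factorial * k.factorial
        else 0 := by
  have val : ∀ s ≤ M + 1, ∀ k ≤ M + 1, tvCoeff F (M + 1) M M s (k - 1) * k
      = if s + k = M + 1 then (-1) ^ s * (M.factorial : F) * s.factorial * k.factorial * k
        else if s + k = M + 2 then - (-1) ^ k * (M.factorial : F) * s.factorial * k.factorial
        else 0 := by
    intro s hs k hk
    rcases k with _ | k
    · simp; omega
    rw [Nat.add_sub_cancel, tvCoeff_full' (by omega), hM.neg_one_pow, ← Nat.cast_sub hs]
    split_ifs with h1 h2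
    · have p : (-1 : F) ^ k = (-1) ^ s := even_parity (by
        rw [show k + s = M by omega]; exact hM)
      rw [p, show M + 1 - s = k + 1 by omega, show M - k = s by omega, Nat.cast_succ,
        fall_succ_self, fall_self]
      ring
    · obtain ⟨s, rfl⟩ : ∃ s', s = s' + 1 := ⟨s - 1, by omega⟩
      rw [show M + 1 - (s + 1) = k by omega, show M - k = s by omega, Nat.cast_succ s,
        fall_succ_self, fall_self, Nat.factorial_succ k]
      push_cast; ring
    · by_cases h : M + 1 - s < k
      · rw [fall_of_lt h]; ring
      · rw [fall_of_lt (F := F) (show s < M - k by omega)]; ring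
  rw [val s hs k hk, val k hk s hs, add_comm k s]
  split_ifs with h1 h2
  · have p : (-1 : F) ^ k = - (-1) ^ s := by
      rw [even_parity (s := k) (k := s + 1) (by
        rw [show k + (s + 1) = M + 2 by omega]; exact hM.add (by decide)), pow_succ]; ring
    have e : (M : F) + 1 = s + k := by exact_mod_cast congrArg (fun z : ℕ => (z : F)) h1.symm
    rw [p, Nat.factorial_succ]
    push_cast
    rw [e]; ring
  · rw [even_parity (s := s) (k := k) (by rw [h2]; exact hM.add (by decide))]; ring
  · ring

theorem minus_aux_one {M : ℕ} (hM : Even M) {s k : ℕ} (hs : s ≤ M + 1) (hk : k ≤ M + 1) :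
    tvCoeff F (M + 1) M M s k * (M + 1 - k) - tvCoeff F (M + 1) M M k s * (M + 1 - s)
      = if s + k = M + 1 then - ((-1) ^ s * ((M + 1).factorial : F) * s.factorial * k.factorial)
        else 0 := by
  have val : ∀ s ≤ M + 1, ∀ k ≤ M + 1, tvCoeff F (M + 1) M M s k * (M + 1 - k)
      = if s + k = M + 1 then (-1) ^ k * (M.factorial : F) * s.factorial * k.factorial * s
        else if s + k = M then (-1) ^ k * (M.factorial : F) * (s + 1).factorial * (k + 1).factorial
        else 0 := by
    intro s hs k hk
    rcases hk.eq_or_lt with rfl | hk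
    · rcases s with _ | s
      · simp
      · simp
        omega
    rw [tvCoeff_full' (by omega), hM.neg_one_pow, ← Nat.cast_sub hs]
    split_ifs with h1 h2
    · obtain ⟨s, rfl⟩ : ∃ s', s = s' + 1 := ⟨s - 1, by omega⟩
      have e : (M : F) = s + k := by
        rw [show M = s + k by omega]; push_cast; ring
      rw [show M + 1 - (s + 1) = k by omega, show M - k = s by omega, Nat.cast_succ s,
        fall_succ_self, fall_self, e]
      push_cast; ring
    · have e : (M : F) = s + k := by rw [← h2]; push_cast; ring
      rw [show M + 1 - s = k + 1 by omega, show M - k = s by omega, Nat.cast_succ k,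
        fall_succ_self, fall_self, Nat.factorial_succ s, e]
      push_cast; ring
    · by_cases h : M + 1 - s < k
      · rw [fall_of_lt h]; ring
      · rw [fall_of_lt (F := F) (show s < M - k by omega)]; ring
  rw [val s hs k hk, val k hk s hs, add_comm k s]
  split_ifs with h1 h2
  · have p : (-1 : F) ^ k = - (-1) ^ s := by
      rw [even_parity (s := k) (k := s + 1) (by
        rw [show k + (s + 1) = M + 2 by omega]; exact hM.add (by decide)), pow_succ]; ring
    have e : (M : F) + 1 = s + k := by exact_mod_cast congrArg (fun z : ℕ => (z : F)) h1.symm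
    rw [p, Nat.factorial_succ]
    push_cast
    rw [e]; ring
  · rw [even_parity (s := s) (k := k) (by rw [h2]; exact hM)]; ring
  · ring

namespace Ladder
variable {n : ℕ}

/-- The module `Z(α, ℓ) = V(α) ⊕ V(α + m) ⊕ ⋯ ⊕ V(α + ℓ m)`, with `m = 2n - 1`. -/
def zInc (F : Type*) [Field F] (n α ℓ : ℕ) : Ladder F n where
  len := ℓ
  wt i := α + i * (2 * n - 1)
  zeta _ := 0
  weight_eq i _ := by
    have e : (i + 1) * (2 * n - 1) = i * (2 * n - 1) + (2 * n - 1) := by ring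
    rw [e]
    omega
  zeta_wt _ _ h := absurd rfl h
  zeta_long _ _ := rfl
  bracket i _ p hp q hq x hx := by
    have r1 (i : ℕ) : (2 * n - 1 + (α + (i + 1) * (2 * n - 1)) - (α + i * (2 * n - 1))) / 2
        = 2 * n - 1 := by
      have e : (i + 1) * (2 * n - 1) = i * (2 * n - 1) + (2 * n - 1) := by ring
      rw [e]; omega
    have r2 : (2 * n - 1 + (α + (i + 2) * (2 * n - 1)) - (α + (i + 1) * (2 * n - 1))) / 2
        = 2 * n - 1 := r1 (i + 1)
    rw [r1, r2]
    refine bracket_of_monomial ?_ hp hq hx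
    intro s hs k hk j hj c d e
    have hw : ((α + (i + 2) * (2 * n - 1) : ℕ) : F)
        = ((α + (i + 1) * (2 * n - 1) : ℕ) : F) + (2 * n - 1 : ℕ) := by
      push_cast; ring
    generalize α + (i + 2) * (2 * n - 1) = b at *
    generalize α + (i + 1) * (2 * n - 1) = b' at *
    generalize 2 * n - 1 = m at *
    have key : ∀ s ≤ m, ∀ k ≤ m, tvCoeff F m b' m s (k + j - m) * tvCoeff F m b m k j
        = (-1) ^ (s + k) * (m.factorial : F) ^ 2 * fall ((b : F) - j) (k + s)
          * fall (j : F) ((m - k) + (m - s)) := by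
      intro s hs k hk
      rw [tvCoeff_full hs, tvCoeff_full hk, fall_add, fall_add]
      by_cases h : j < m - k
      · rw [fall_of_lt h]; ring
      · have e : ((k + j - m : ℕ) : F) = j - (m - k : ℕ) := by
          rw [← Nat.cast_sub (by omega)]; congr 1; omega
        have e' : (b' : F) - (k + j - m : ℕ) = b - j - k := by
          rw [hw, Nat.cast_sub (by omega)]; push_cast; ring
        rw [e', e]; ring
    have key2 : ∀ s ≤ m, ∀ k ≤ m, s + (k + j - m) - m ≠ k + (s + j - m) - m →
        fall (j : F) ((m - k) + (m - s)) = 0 := by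
      intro s hs k hk h
      exact fall_of_lt (by omega)
    have k1 := key s hs k hk
    have k2 := key k hk s hs
    simp only [transvectant_monomial, mul_zero, zero_smul]
    rw [sub_eq_zero]
    have ec : tvCoeff F m b' m s (k + j - m) * c * (tvCoeff F m b m k j * d * e)
        = tvCoeff F m b' m k (s + j - m) * d * (tvCoeff F m b m s j * c * e) := by
      rw [add_comm s k] at k1
      rw [add_comm (m - s), add_comm s k] at k2
      linear_combination c * d * e * (k1 - k2)
    by_cases h : s + (k + j - m) - m = k + (s + j - m) - m
    · rw [h, ec]
    · have h0 := key2 s hs k hk h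
      rw [h0, mul_zero] at k1
      rw [← ec, show tvCoeff F m b' m s (k + j - m) * c * (tvCoeff F m b m k j * d * e) = 0 by
        linear_combination c * d * e * k1]
      simp

/-- The module `Z(α, ℓ)^* = V(α + ℓ m) ⊕ ⋯ ⊕ V(α + m) ⊕ V(α)`, with `m = 2n - 1`; here `V(α + ℓ m)`
is the socle. -/
def zDec (F : Type*) [Field F] (n α ℓ : ℕ) : Ladder F n where
  len := ℓ
  wt i := α + (ℓ - i) * (2 * n - 1)
  zeta _ := 0
  weight_eq i h := by
    have e : (ℓ - i) * (2 * n - 1) = (ℓ - (i + 1)) * (2 * n - 1) + (2 * n - 1) := by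
      rw [show ℓ - i = (ℓ - (i + 1)) + 1 by omega]; ring
    rw [e]; omega
  zeta_wt _ _ h := absurd rfl h
  zeta_long _ _ := rfl
  bracket i hi p hp q hq x hx := by
    have r1 : ∀ i < ℓ, (2 * n - 1 + (α + (ℓ - (i + 1)) * (2 * n - 1))
        - (α + (ℓ - i) * (2 * n - 1))) / 2 = 0 := by
      intro i h
      have e : (ℓ - i) * (2 * n - 1) = (ℓ - (i + 1)) * (2 * n - 1) + (2 * n - 1) := by
        rw [show ℓ - i = (ℓ - (i + 1)) + 1 by omega]; ring
      rw [e]; omega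
    have r2 : (2 * n - 1 + (α + (ℓ - (i + 2)) * (2 * n - 1))
        - (α + (ℓ - (i + 1)) * (2 * n - 1))) / 2 = 0 := r1 (i + 1) (by omega)
    rw [r1 i (by omega), r2]
    simp only [transvectant_zero, mul_zero, zero_smul]
    ring

/-- With `m = 2n - 1`, the module `V(a) ⊕ V(a + m) ⊕ V(a)`, where `n = 1` or `a = 0, 1`. -/
def fuPlus (F : Type*) [Field F] (n a : ℕ) (h : n = 1 ∨ 1 ≤ n ∧ a ≤ 1) : Ladder F n where
  len := 2
  wt i := if i = 1 then a + (2 * n - 1) else a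
  zeta _ := a * (2 * n - 1 : ℕ) + 2
  weight_eq i hi := by
    obtain rfl | rfl : i = 0 ∨ i = 1 := by omega
    · simp; omega
    · simp; omega
  zeta_wt i hi _ := by
    obtain rfl : i = 0 := by omega
    rfl
  zeta_long h := absurd h (by norm_num)
  bracket i hi p hp q hq x hx := by
    obtain rfl : i = 0 := by omega
    simp only [zero_add, if_true, if_neg (show (0 : ℕ) ≠ 1 by omega),
      if_neg (show (2 : ℕ) ≠ 1 by omega)] at hx ⊢
    rw [show (2 * n - 1 + (a + (2 * n - 1)) - a) / 2 = 2 * n - 1 by omega,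
      show (2 * n - 1 + a - (a + (2 * n - 1))) / 2 = 0 by omega]
    refine bracket_of_monomial ?_ hp hq hx
    intro s hs k hk j hj c d e
    rw [transvectant_zero, transvectant_zero, monomial_mul_monomial, monomial_mul_monomial, transvectant_monomial,
      transvectant_monomial, smul_monomial, heisForm_monomial hs, show k + (s + j) = s + (k + j) by omega,
      ← map_sub, tvCoeff_full hs, tvCoeff_full hk, smul_eq_mul]
    have hm : Odd (2 * n - 1) := ⟨n - 1, by omega⟩
    have key := plus_aux (F := F) hm (a := a) (by omega) hs hk hj
    push_cast
    by_cases hsk : s + k = 2 * n - 1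
    · rw [if_pos hsk] at key ⊢
      rw [show s + (k + j) - (2 * n - 1) = j by omega]
      congr 1
      linear_combination (c * d * e) * key
    · rw [if_neg hsk] at key ⊢
      have h0 : ∀ u v : F, u - v = 0 → u * c * (d * e) - v * d * (c * e) = 0 := by
        intro u v h
        linear_combination c * d * e * h
      rw [h0 _ _ key]
      simp


/-- The module `V(a) ⊕ V(a - 1) ⊕ V(a)` for `n = 1`. -/
def fuMinusOne (F : Type*) [Field F] (n : ℕ) (hn : n = 1) (a : ℕ) (ha : 1 ≤ a) : Ladder F n where
  len := 2
  wt i := if i = 1 then a - 1 else a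
  zeta _ := -(a : F)
  weight_eq i hi := by
    subst hn
    obtain rfl | rfl : i = 0 ∨ i = 1 := by omega
    · simp; omega
    · simp; omega
  zeta_wt i hi _ := by
    obtain rfl : i = 0 := by omega
    rfl
  zeta_long h := absurd h (by norm_num)
  bracket i hi p hp q hq x hx := by
    subst hn
    obtain rfl : i = 0 := by omega
    simp only [zero_add, if_true, if_neg (show (0 : ℕ) ≠ 1 by omega),
      if_neg (show (2 : ℕ) ≠ 1 by omega)] at hx ⊢
    rw [show (2 * 1 - 1 + (a - 1) - a) / 2 = 0 by omega,
      show (2 * 1 - 1 + a - (a - 1)) / 2 = 1 by omega]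
    refine bracket_of_monomial ?_ hp hq hx
    intro s hs k hk j hj c d e
    rw [transvectant_zero, transvectant_zero, transvectant_monomial, transvectant_monomial, monomial_mul_monomial,
      monomial_mul_monomial, smul_monomial, heisForm_monomial hs, tvCoeff_one, tvCoeff_one, smul_eq_mul]
    obtain rfl | rfl : s = 0 ∨ s = 1 := by omega
    · obtain rfl | rfl : k = 0 ∨ k = 1 := by omega
      · simp; ring_nf
      · rcases j with _ | j
        · simp; ring_nf
        · rw [if_pos (by omega), show 0 + (1 + (j + 1) - 1) = j + 1 by omega,
            show 1 + (0 + (j + 1) - 1) = j + 1 by omega, ← map_sub]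
          congr 1
          simp
          ring
    · obtain rfl | rfl : k = 0 ∨ k = 1 := by omega
      · rcases j with _ | j
        · simp; ring_nf
        · rw [if_pos (by omega), show 0 + (1 + (j + 1) - 1) = j + 1 by omega,
            show 1 + (0 + (j + 1) - 1) = j + 1 by omega, ← map_sub]
          congr 1
          simp
          ring
      · simp; ring_nf

/-- With `m = 2n - 1`, the module `V(1) ⊕ V(m - 1) ⊕ V(1)` for `n ≥ 2`. -/
def fuMinus (F : Type*) [Field F] (n : ℕ) (hn : 2 ≤ n) : Ladder F n where
  len := 2
  wt i := if i = 1 then 2 * n - 1 - 1 else 1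
  zeta _ := -1
  weight_eq i hi := by
    obtain rfl | rfl : i = 0 ∨ i = 1 := by omega
    · simp; omega
    · simp; omega
  zeta_wt i hi _ := by
    obtain rfl : i = 0 := by omega
    rfl
  zeta_long h := absurd h (by norm_num)
  bracket i hi p hp q hq x hx := by
    obtain rfl : i = 0 := by omega
    simp only [zero_add, if_true, if_neg (show (0 : ℕ) ≠ 1 by omega),
      if_neg (show (2 : ℕ) ≠ 1 by omega)] at hx ⊢
    rw [show (2 * n - 1 + (2 * n - 1 - 1) - 1) / 2 = 2 * n - 1 - 1 by omega,
      show (2 * n - 1 + 1 - (2 * n - 1 - 1)) / 2 = 1 by omega]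
    refine bracket_of_monomial ?_ hp hq hx
    intro s hs k hk j hj c d e
    obtain ⟨M, hM⟩ : ∃ M, 2 * n - 1 = M + 1 := ⟨2 * n - 1 - 1, by omega⟩
    have hMe : Even M := ⟨n - 1, by omega⟩
    rw [transvectant_monomial, transvectant_monomial, transvectant_monomial, transvectant_monomial, smul_monomial,
      heisForm_monomial hs, tvCoeff_one, tvCoeff_one, smul_eq_mul, hM, Nat.add_sub_cancel]
    rw [hM] at hs hk
    obtain rfl | rfl : j = 0 ∨ j = 1 := by omega
    · have key := minus_aux_zero (F := F) hMe hs hk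
      simp only [add_zero, Nat.cast_zero, mul_zero, Nat.cast_one, sub_zero, mul_one, zero_sub]
      have m1 : ∀ s k : ℕ, ∀ c d : F,
          (monomial (s + (k - 1) - M) (tvCoeff F (M + 1) M M s (k - 1) * c * (-(k : F) * d * e)) : F[X])
          = monomial (s + k - (M + 1)) (-(tvCoeff F (M + 1) M M s (k - 1) * k) * (c * d * e)) := by
        intro s k c d
        rcases k with _ | k
        · simp
        · rw [show s + (k + 1 - 1) - M = s + (k + 1) - (M + 1) by omega]
          congr 1; ring
      rw [m1, m1, add_comm k s, ← map_sub]
      by_cases h : s + k = M + 1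
      · rw [if_pos h] at key ⊢
        rw [h, Nat.sub_self]
        congr 1
        linear_combination (-(c * d * e)) * key
      · rw [if_neg h] at key ⊢
        rw [show (0 : F) * -1 * e = 0 by ring, map_zero,
          show -(tvCoeff F (M + 1) M M s (k - 1) * k) * (c * d * e)
            - -(tvCoeff F (M + 1) M M k (s - 1) * s) * (d * c * e) = 0 by
            linear_combination (-(c * d * e)) * key, map_zero]
    · have key := minus_aux_one (F := F) hMe hs hk
      simp only [Nat.add_sub_cancel, Nat.cast_one, mul_one, sub_self, mul_zero, sub_zero]
      rw [add_comm k s, ← map_sub]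
      push_cast
      by_cases h : s + k = M + 1
      · rw [if_pos h] at key ⊢
        rw [show s + k - M = 1 by omega]
        congr 1
        linear_combination (c * d * e) * key
      · rw [if_neg h] at key ⊢
        rw [show (0 : F) * -1 * e = 0 by ring, map_zero,
          show tvCoeff F (M + 1) M M s k * c * ((M + 1 - k) * d * e)
            - tvCoeff F (M + 1) M M k s * d * ((M + 1 - s) * c * e) = 0 by
            linear_combination (c * d * e) * key, map_zero]

end Ladder

/-- The list of the standard faithful uniserial modules of `sl(2) ⋉ h_n` up to isomorphism,
with `m = 2n - 1`. -/
inductive StandardFaithful (n : ℕ) : Type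
  /-- `FU_a^+ = V(a) ⊕ V(a+1) ⊕ V(a)`, for `n = 1`. -/
  | plus (hn : n = 1) (a : ℕ)
  /-- `FU_a^- = V(a) ⊕ V(a-1) ⊕ V(a)`, for `n = 1` and `a ≥ 1`. -/
  | minus (hn : n = 1) (a : ℕ) (ha : 1 ≤ a)
  /-- `FU_{(a,a+m,a)} = V(a) ⊕ V(a+m) ⊕ V(a)`, for `n ≥ 2` and `a = 0, 1`. -/
  | up (hn : 2 ≤ n) (a : ℕ) (ha : a ≤ 1)
  /-- `FU_{(1,m-1,1)} = V(1) ⊕ V(m-1) ⊕ V(1)`, for `n ≥ 2`. -/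
  | down (hn : 2 ≤ n)

/-- The module attached to an entry of the list. -/
def StandardFaithful.ladder (F : Type*) [Field F] {n : ℕ} : StandardFaithful n → Ladder F n
  | .plus hn a => Ladder.fuPlus F n a (Or.inl hn)
  | .minus hn a ha => Ladder.fuMinusOne F n hn a ha
  | .up hn a ha => Ladder.fuPlus F n a (Or.inr ⟨by omega, ha⟩)
  | .down hn => Ladder.fuMinus F n hn

/-- The modules of type `Z`. -/
inductive TypeZ : Type
  /-- `Z(α, ℓ)`. -/
  | Z (α ℓ : ℕ)
  /-- `Z(α, ℓ)^*`. -/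
  | Zdual (α ℓ : ℕ)

/-- The module of type `Z` attached to its name. -/
def TypeZ.ladder (F : Type*) [Field F] (n : ℕ) : TypeZ → Ladder F n
  | .Z α ℓ => Ladder.zInc F n α ℓ
  | .Zdual α ℓ => Ladder.zDec F n α ℓ

section Arrows

variable {n : ℕ} [NeZero n] [CharZero F]

/-- The summand `V(a_i)` of the module of a ladder. -/
def Ladder.layer (D : Ladder F n) (i : ℕ) : Submodule F D.Mod where
  carrier := {x | ∀ j, j ≠ i → x.1 j = 0}
  add_mem' {x y} hx hy j hj := by
    change x.1 j + y.1 j = 0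
    rw [hx j hj, hy j hj, add_zero]
  zero_mem' _ _ := rfl
  smul_mem' c x hx j hj := by
    change c • x.1 j = 0
    rw [hx j hj, smul_zero]

variable {V W : Type*}
  [AddCommGroup V] [Module F V] [LieRingModule (GalileanAlgebra F n) V]
  [LieModule F (GalileanAlgebra F n) V]
  [AddCommGroup W] [Module F W] [LieRingModule (GalileanAlgebra F n) W]
  [LieModule F (GalileanAlgebra F n) W]

/-- The summand `V(a_i)` of a module identified with the module of a ladder. -/
def layerOf {D : Ladder F n} (eV : V ≃ₗ⁅F, GalileanAlgebra F n⁆ D.Mod) (i : ℕ) : Submodule F V :=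
  (D.layer i).comap (eV : V →ₗ[F] D.Mod)

/-- For `V = V(a_0) ⊕ ⋯ ⊕ V(a_ℓ)` and `W = V(b_0) ⊕ ⋯ ⊕ V(b_ℓ')`: the homomorphism `φ : V → W` is
described by the arrows `V(a_i) → V(b_{i-s})`, `s ≤ i ≤ ℓ`. That is, it vanishes
on `V(a_i)` for `i < s` and maps `V(a_i)` bijectively onto `V(b_{i-s})` for `s ≤ i ≤ ℓ`. -/
def IsArrow {D E : Ladder F n} (eV : V ≃ₗ⁅F, GalileanAlgebra F n⁆ D.Mod)
    (eW : W ≃ₗ⁅F, GalileanAlgebra F n⁆ E.Mod) (s : ℕ) (φ : V →ₗ⁅F, GalileanAlgebra F n⁆ W) : Prop :=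
  ∀ i ≤ D.len, (i < s → ∀ x ∈ layerOf eV i, φ x = 0) ∧
    (s ≤ i → Set.BijOn φ (layerOf eV i) (layerOf eW (i - s)))

/-- `Hom(V, W)` is one-dimensional, and its non-zero elements are described by the arrows
`V(a_i) → V(b_{i-s})`, `i ≥ s`. -/
def HomIsArrow {D E : Ladder F n} (eV : V ≃ₗ⁅F, GalileanAlgebra F n⁆ D.Mod)
    (eW : W ≃ₗ⁅F, GalileanAlgebra F n⁆ E.Mod) (s : ℕ) : Prop :=
  Module.finrank F (V →ₗ⁅F, GalileanAlgebra F n⁆ W) = 1 ∧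
    ∀ φ : V →ₗ⁅F, GalileanAlgebra F n⁆ W, φ ≠ 0 → IsArrow eV eW s φ

end Arrows

/-- The pairs `V` standard faithful, `W = V(b_0) ⊕ ⋯ ⊕ V(b_ℓ)` of type `Z` with non-zero
homomorphisms `V → W` given by two arrows `V(a_1) → V(b_0)`, `V(a_2) → V(b_1)`. -/
inductive TwoArrowsToZ {n : ℕ} : StandardFaithful n → TypeZ → Prop
  /-- `n = 1`, `V = FU_a^-`, `W = Z(b_0, ℓ)`, `ℓ ≥ 1`, `a = b_1 = b_0 + 1`. -/
  | minus (hn : n = 1) (a : ℕ) (ha : 1 ≤ a) (b ℓ : ℕ) (hℓ : 1 ≤ ℓ) (h : a = b + 1) :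
      TwoArrowsToZ (.minus hn a ha) (.Z b ℓ)
  /-- `n = 1`, `V = FU_a^+`, `W = Z(b_ℓ, ℓ)^*`, `ℓ ≥ 1`, `a = b_1 = b_ℓ + ℓ - 1`. -/
  | plus (hn : n = 1) (a : ℕ) (b ℓ : ℕ) (hℓ : 1 ≤ ℓ) (h : a = b + (ℓ - 1)) :
      TwoArrowsToZ (.plus hn a) (.Zdual b ℓ)
  /-- `n > 1`, `V = FU_{(a,a+m,a)}`, `W = Z(a, 1)^*`, `a = 0, 1`. -/
  | up (hn : 2 ≤ n) (a : ℕ) (ha : a ≤ 1) : TwoArrowsToZ (.up hn a ha) (.Zdual a 1)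

/-- The pairs `W = V(b_0) ⊕ ⋯ ⊕ V(b_ℓ)` of type `Z`, `V` standard faithful with non-zero
homomorphisms `W → V` given by two arrows `V(b_{ℓ-1}) → V(a_0)`, `V(b_ℓ) → V(a_1)`. -/
inductive TwoArrowsFromZ {n : ℕ} : TypeZ → StandardFaithful n → Prop
  /-- `n = 1`, `V = FU_a^+`, `W = Z(b_0, ℓ)`, `ℓ ≥ 1`, `a = b_{ℓ-1} = b_0 + ℓ - 1`. -/
  | plus (hn : n = 1) (a : ℕ) (b ℓ : ℕ) (hℓ : 1 ≤ ℓ) (h : a = b + (ℓ - 1)) :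
      TwoArrowsFromZ (.Z b ℓ) (.plus hn a)
  /-- `n = 1`, `V = FU_a^-`, `W = Z(b_ℓ, ℓ)^*`, `ℓ ≥ 1`, `a = b_{ℓ-1} = b_ℓ + 1`. -/
  | minus (hn : n = 1) (a : ℕ) (ha : 1 ≤ a) (b ℓ : ℕ) (hℓ : 1 ≤ ℓ) (h : a = b + 1) :
      TwoArrowsFromZ (.Zdual b ℓ) (.minus hn a ha)
  /-- `n > 1`, `V = FU_{(a,a+m,a)}`, `W = Z(a, 1)`, `a = 0, 1`. -/
  | up (hn : 2 ≤ n) (a : ℕ) (ha : a ≤ 1) : TwoArrowsFromZ (.Z a 1) (.up hn a ha)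

/-- The pairs `V`, `W` of standard faithful modules with non-zero homomorphisms `V → W` given by two
arrows `V(a_1) → V(b_0)`, `V(a_2) → V(b_1)`. -/
inductive TwoArrows {n : ℕ} : StandardFaithful n → StandardFaithful n → Prop
  /-- `n = 1`, `V = FU_a^-`, `W = FU_b^+`, `a = b_1 = b + 1`. -/
  | minusPlus (hn : n = 1) (a : ℕ) (ha : 1 ≤ a) (b : ℕ) (h : a = b + 1) :
      TwoArrows (.minus hn a ha) (.plus hn b)
  /-- `n = 1`, `V = FU_a^+`, `W = FU_b^-`, `a = b_1 = b - 1`. -/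
  | plusMinus (hn : n = 1) (a : ℕ) (b : ℕ) (hb : 1 ≤ b) (h : a + 1 = b) :
      TwoArrows (.plus hn a) (.minus hn b hb)

end

end Galilean

namespace Galilean

noncomputable section

open Polynomial

variable {F : Type*} [Field F]

/-! Write `m = 2n - 1`. In every module considered, `V(m)` lowers the layer by one and `z` lowers it
by two. Let `φ` be a homomorphism from `V(a_0) ⊕ V(a_1) ⊕ ⋯` to `V(b_0) ⊕ V(b_1) ⊕ ⋯`. By Schur's
lemma the block `V(a_i) → V(b_j)` is a scalar `c_{ij}`, which vanishes unless `a_i = b_j`. The map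
`V(m) ⊗ V(a_{i+1}) → V(a_i)` is a non-zero transvectant that depends on the two weights only, so
commutation with `V(m)` gives `c_{ij} = c_{i+1,j+1}` and `c_{0,j+1} = 0`, with no rescaling. The
matrix is therefore constant along diagonals and vanishes for `i < j`: `φ = ∑ γ_s · (shift by s)`.
If `γ_s ≠ 0`, every arrow of the diagonal `s` is non-zero, so all its weights match; this is the
condition `Shiftable`, and the statement is `Ladder.exists_shift_scalars`.

Conversely, a shift along matching weights commutes with `sl(2)` and `V(m)`. Commutation with `z` is
a condition only if three layers survive (`Ladder.shift`).

What remains is arithmetic of weights. From a standard faithful `V` only the shifts by 0, 1, 2 are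
possible. The shift by 2 needs `a_0 = b_0`; the shift by 1 needs `a_1 = b_0` and `a_0 = b_1`; they
exclude each other because `a_0 ≠ a_1`. The shift by 0 would put equal weights two layers apart:
impossible in type `Z`, where the weights are strictly monotone, and possible between standard
faithful modules only if these coincide. For the same reason only the last two shifts from type `Z`
to `V` can occur. The resulting numerical conditions are matched with the lists of exceptional pairs
in `twoArrowsToZ_iff`, `twoArrowsFromZ_iff` and `twoArrows_iff`. -/

/-! ### Non-vanishing of transvectants and Schur's lemma. -/

theorem tvCoeff_zero_self_ne_zero [CharZero F] {m b r : ℕ} (hm : r ≤ m) :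
    tvCoeff F m b r 0 r ≠ 0 := by
  have h : tvCoeff F m b r 0 r = fall (m : F) r * fall (r : F) r := by
    unfold tvCoeff tvSum
    -- Since `s = 0`, the factor `fall 0 l` kills every term with `l > 0`. The surviving product of
    -- falling factorials is non-zero in characteristic 0 because `r ≤ m`.
    rw [Finset.sum_eq_single 0]
    · simp [fall_zero]
    · intro l _ hl
      rw [fall_of_lt (F := F) (Nat.pos_of_ne_zero hl)]
      ring
    · simp
  rw [h, fall_natCast, fall_natCast]
  refine mul_ne_zero ?_ ?_ <;> rw [Nat.cast_ne_zero] <;>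
    exact fun h0 => absurd (Nat.descFactorial_eq_zero_iff_lt.1 h0) (by omega)

/-- The witness is `1 ⊗ X^r`, which goes to a non-zero constant, a highest weight vector of the
target; `r ≤ b` is what puts `X^r` in `V(b)`. -/
theorem exists_transvectant_ne_zero [CharZero F] {m b r : ℕ} (hm : r ≤ m) (hb : r ≤ b) :
    ∃ p ∈ irr F m, ∃ q ∈ irr F b, transvectant m b r p q ≠ 0 := by
  refine ⟨monomial 0 1, monomial_mem_irr _ (Or.inl (Nat.zero_le m)), monomial r 1,
    monomial_mem_irr _ (Or.inl hb), ?_⟩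
  rw [transvectant_monomial]
  simpa using tvCoeff_zero_self_ne_zero hm

/-- The element `!![y, x; z, -y]` of `sl(2)`. -/
def SL2.mk (x y z : F) : SL2 F := ⟨!![y, x; z, -y], by
  change Matrix.trace (!![y, x; z, -y] : Matrix (Fin 2) (Fin 2) F) = 0
  simp [Matrix.trace_fin_two]⟩

/-- Schur's lemma for the modules `V(a)`. -/
theorem exists_eq_smul_of_equivariant [CharZero F] {a b : ℕ} (ψ : irr F a →ₗ[F] F[X])
    (h : ∀ (A : SL2 F) (x : irr F a), ψ ⟨slAct a A x.1, slAct_mem a A x.2⟩ = slAct b A (ψ x)) :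
    ∃ c : F, (c ≠ 0 → a = b) ∧ ∀ x : irr F a, ψ x = c • x.1 := by
  have hmem (s : ℕ) (hs : s ≤ a) (d : F) : monomial s d ∈ irr F a :=
    monomial_mem_irr _ (Or.inl hs)
  have h' (A : SL2 F) (s : ℕ) (hs : s ≤ a) (q : F[X]) (hq : slAct a A (monomial s 1) = q)
      (hq' : q ∈ irr F a) : ψ ⟨q, hq'⟩ = slAct b A (ψ ⟨monomial s 1, hmem s hs 1⟩) := by
    subst hq
    exact h A ⟨monomial s 1, hmem s hs 1⟩
  -- The polynomial `1` is the highest weight vector: `e` acts as the derivative and kills it, so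
  -- its image is a constant `c`.
  set v := ψ ⟨monomial 0 1, hmem 0 (Nat.zero_le a) 1⟩ with hv
  have he : derivative v = 0 := by
    have := h' (SL2.mk 1 0 0) 0 (Nat.zero_le a) 0 (by rw [slAct_monomial]; simp [SL2.mk])
      (zero_mem _)
    rw [← hv, slAct_apply, show (⟨0, zero_mem _⟩ : irr F a) = 0 from rfl, map_zero] at this
    simpa [SL2.mk] using this.symm
  obtain ⟨c, hc⟩ : ∃ c, v = C c := ⟨_, eq_C_of_derivative_eq_zero he⟩
  -- Comparison of the `h`-eigenvalues of `1` and of its image.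
  have hab : ((a : F) - b) * c = 0 := by
    have h1 := h' (SL2.mk 0 1 0) 0 (Nat.zero_le a) ((a : F) • monomial 0 1)
      (by rw [slAct_monomial, smul_monomial]; simp [SL2.mk])
      (Submodule.smul_mem _ _ (hmem 0 (Nat.zero_le a) 1))
    rw [show (⟨(a : F) • monomial 0 1, Submodule.smul_mem _ _ (hmem 0 (Nat.zero_le a) 1)⟩ : irr F a)
      = (a : F) • ⟨monomial 0 1, hmem 0 (Nat.zero_le a) 1⟩ from rfl, map_smul, ← hv, hc,
      ← monomial_zero_left, slAct_monomial, smul_monomial] at h1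
    have h2 := congrArg (fun p => p.coeff 0) h1
    simp [SL2.mk] at h2
    rcases h2 with h2 | h2
    · rw [h2]; ring
    · rw [h2]; ring
  refine ⟨c, fun h0 => ?_, fun x => ?_⟩
  · rcases mul_eq_zero.1 hab with h1 | h1
    · exact_mod_cast sub_eq_zero.1 h1
    · exact absurd h1 h0
  -- Since `f X^s = (a - s) X^(s+1)` and `a - s ≠ 0` for `s < a`, the image of `1` determines the
  -- images of all monomials; `hab` replaces the factor `b - s` on the target side by `a - s`.
  have hmon (s : ℕ) (hs : s ≤ a) : ψ ⟨monomial s 1, hmem s hs 1⟩ = monomial s c := by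
    induction s with
    | zero => rw [← hv, hc, monomial_zero_left]
    | succ s ih =>
      have h1 := h' (SL2.mk 0 0 1) s (by omega) (((a : F) - s) • monomial (s + 1) 1)
        (by rw [slAct_monomial]; simp [SL2.mk, smul_monomial])
        (Submodule.smul_mem _ _ (hmem (s + 1) hs 1))
      rw [show (⟨((a : F) - s) • monomial (s + 1) 1,
        Submodule.smul_mem _ _ (hmem (s + 1) hs 1)⟩ : irr F a)
        = ((a : F) - s) • ⟨monomial (s + 1) 1, hmem (s + 1) hs 1⟩ from rfl, map_smul,
        ih (by omega), slAct_monomial] at h1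
      have hne : (a : F) - s ≠ 0 := sub_ne_zero.2 (by exact_mod_cast (by omega : a ≠ s))
      apply smul_right_injective _ hne
      simp only [h1, SL2.mk, smul_monomial]
      simp
      congr 1
      linear_combination -hab
  obtain ⟨x, hx⟩ := x
  suffices ∃ hx : x ∈ irr F a, ψ ⟨x, hx⟩ = c • x from this.2
  refine irr_induction (P := fun x => ∃ hx : x ∈ irr F a, ψ ⟨x, hx⟩ = c • x) ?_ ?_ hx
  · rintro p q ⟨hp, hp'⟩ ⟨hq, hq'⟩
    refine ⟨add_mem hp hq, ?_⟩
    rw [smul_add, ← hp', ← hq', ← map_add]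
    rfl
  · intro s d hs
    have hx := hmem s hs d
    refine ⟨hx, ?_⟩
    have : (⟨monomial s d, hx⟩ : irr F a) = d • ⟨monomial s 1, hmem s hs 1⟩ :=
      Subtype.ext (by simp [smul_monomial])
    rw [this, map_smul, hmon s hs, smul_monomial, smul_monomial, smul_eq_mul, smul_eq_mul, mul_comm]

theorem slAct_zero_left (a : ℕ) (p : F[X]) : slAct a (0 : SL2 F) p = 0 := by
  have := slAct_smul_left a (0 : F) 0 p
  rwa [zero_smul, zero_smul] at this

/-! ### Ladders: coordinates, and the matrix of scalars of a homomorphism. -/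

namespace Ladder

variable {n : ℕ} (D E : Ladder F n)

/-- The degree of the transvectant by which `V(2n-1)` maps `V(a_{i+1})` to `V(a_i)`. -/
def tvDeg (i : ℕ) : ℕ := (2 * n - 1 + D.wt (i + 1) - D.wt i) / 2

/-- All the maps `V(2n-1) ⊗ V(a_{i+1}) → V(a_i)` are non-zero. -/
def Nondegenerate : Prop := ∀ i < D.len, D.tvDeg i ≤ 2 * n - 1 ∧ D.tvDeg i ≤ D.wt (i + 1)

/-- The arrows `V(a_{i+s}) → V(b_i)`, `i + s ≤ len`, define an `sl(2) ⋉ h_n`-homomorphism. -/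
structure Shiftable (s : ℕ) : Prop where
  le_len : s ≤ D.len
  len_le : D.len ≤ E.len + s
  wt_eq : ∀ i, i + s ≤ D.len → D.wt (i + s) = E.wt i

@[ext] theorem Mod.ext {D : Ladder F n} {x y : D.Mod} (h : ∀ i, x.1 i = y.1 i) : x = y :=
  Subtype.ext (funext h)

/-- The coordinate in `V(a_i)`. -/
def coord (i : ℕ) : D.Mod →ₗ[F] F[X] := LinearMap.proj i ∘ₗ D.carrier.subtype

/-- The inclusion of `V(a_i)`. -/
def single (i : ℕ) (hi : i ≤ D.len) : irr F (D.wt i) →ₗ[F] D.Mod :=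
  (LinearMap.single F (fun _ => F[X]) i ∘ₗ (irr F (D.wt i)).subtype).codRestrict D.carrier
    fun p j => by
      rcases eq_or_ne j i with rfl | h
      · simpa using fun h => absurd h (by omega)
      · simp [h]

theorem single_apply (i : ℕ) (hi : i ≤ D.len) (p : irr F (D.wt i)) (j : ℕ) :
    (D.single i hi p).1 j = if j = i then p.1 else 0 := by
  change (Pi.single i p.1 : ℕ → F[X]) j = _
  rw [Pi.single_apply]

theorem sum_apply {ι : Type*} (s : Finset ι) (f : ι → D.Mod) (j : ℕ) :
    (∑ i ∈ s, f i).1 j = ∑ i ∈ s, (f i).1 j := map_sum (D.coord j) f s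

/-- The component of an element in `V(a_i)`. -/
def component (x : D.Mod) (i : Fin (D.len + 1)) : irr F (D.wt i) :=
  ⟨x.1 i, (x.2 i).1 (by omega)⟩

theorem sum_single (x : D.Mod) :
    ∑ i : Fin (D.len + 1), D.single i (by omega) (D.component x i) = x := by
  ext1 j
  rw [sum_apply]
  simp only [single_apply, component]
  by_cases hj : j ≤ D.len
  · rw [Finset.sum_eq_single ⟨j, by omega⟩]
    · simp
    · intro i _ hi
      rw [if_neg]
      rintro rfl
      exact hi rfl
    · simp
  · rw [(x.2 j).2 (by omega)]
    refine Finset.sum_eq_zero fun i _ => ?_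
    rw [if_neg (by omega)]

theorem exists_tv_ne_zero [CharZero F] {D : Ladder F n} (hD : D.Nondegenerate) {i : ℕ} (hi : i < D.len) :
    ∃ p : irr F (2 * n - 1), ∃ x : irr F (D.wt (i + 1)),
      transvectant (2 * n - 1) (D.wt (i + 1)) (D.tvDeg i) p.1 x.1 ≠ 0 := by
  obtain ⟨p, hp, x, hx, h⟩ := exists_transvectant_ne_zero (F := F) (hD i hi).1 (hD i hi).2
  exact ⟨⟨p, hp⟩, ⟨x, hx⟩, h⟩

variable [NeZero n] [CharZero F]

theorem lie_apply (g : GalileanAlgebra F n) (x : D.Mod) (i : ℕ) :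
    (⁅g, x⁆ : D.Mod).1 i = D.act g x.1 i := rfl

/-- The element of `V(2n-1) ⊆ h_n ⊆ sl(2) ⋉ h_n` given by a form. -/
def heis (p : irr F (2 * n - 1)) : GalileanAlgebra F n := ⟨((p, 0) : _ × _), 0⟩

/-- The element of `sl(2) ⊆ sl(2) ⋉ h_n` given by a matrix. -/
def slIncl (n : ℕ) [NeZero n] (A : SL2 F) : GalileanAlgebra F n := ⟨0, A⟩

theorem heis_lie_apply (p : irr F (2 * n - 1)) (x : D.Mod) (i : ℕ) :
    (⁅heis p, x⁆ : D.Mod).1 i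
      = transvectant (2 * n - 1) (D.wt (i + 1)) (D.tvDeg i) p.1 (x.1 (i + 1)) := by
  rw [lie_apply, act]
  change slAct _ 0 _ + transvectant _ _ _ p.1 _ + ((0 : F) * _) • _ = _
  rw [slAct_zero_left, zero_mul, zero_smul, zero_add, add_zero]
  rfl

theorem slIncl_lie_apply (A : SL2 F) (x : D.Mod) (i : ℕ) :
    (⁅slIncl n A, x⁆ : D.Mod).1 i = slAct (D.wt i) A (x.1 i) := by
  rw [lie_apply, act]
  change slAct _ A _ + transvectant _ _ _ 0 _ + ((0 : F) * _) • _ = _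
  rw [map_zero, LinearMap.zero_apply, zero_mul, zero_smul, add_zero, add_zero]

theorem slIncl_lie_single (A : SL2 F) (i : ℕ) (hi : i ≤ D.len) (x : irr F (D.wt i)) :
    ⁅slIncl n A, D.single i hi x⁆ = D.single i hi ⟨slAct (D.wt i) A x.1, slAct_mem _ A x.2⟩ := by
  ext1 j
  rw [slIncl_lie_apply, single_apply, single_apply]
  split_ifs with h
  · rw [h]
  · rw [map_zero]

theorem heis_lie_single_zero (p : irr F (2 * n - 1)) (x : irr F (D.wt 0)) :
    ⁅heis p, D.single 0 (Nat.zero_le _) x⁆ = 0 := by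
  ext1 j
  rw [heis_lie_apply, single_apply, if_neg (by omega), map_zero]
  rfl

theorem heis_lie_single_succ (p : irr F (2 * n - 1)) (i : ℕ) (hi : i + 1 ≤ D.len)
    (x : irr F (D.wt (i + 1))) :
    ⁅heis p, D.single (i + 1) hi x⁆ = D.single i (by omega)
      ⟨transvectant (2 * n - 1) (D.wt (i + 1)) (D.tvDeg i) p.1 x.1,
        transvectant_mem (D.weight_eq i hi) p.2 x.2⟩ := by
  ext1 j
  rw [heis_lie_apply, single_apply, single_apply]
  by_cases h : j = i
  · rw [if_pos h, if_pos (by omega), h]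
  · rw [if_neg h, if_neg (by omega), map_zero]

variable {D E}

/-- A homomorphism between ladders is given by a matrix of scalars. -/
theorem exists_scalars (φ : D.Mod →ₗ⁅F, GalileanAlgebra F n⁆ E.Mod) (i j : ℕ) (hi : i ≤ D.len) :
    ∃ c : F, (c ≠ 0 → j ≤ E.len ∧ D.wt i = E.wt j) ∧
      ∀ x, (φ (D.single i hi x)).1 j = c • x.1 := by
  obtain ⟨c, hc, h⟩ := exists_eq_smul_of_equivariant (b := E.wt j)
    (E.coord j ∘ₗ (φ : D.Mod →ₗ[F] E.Mod) ∘ₗ D.single i hi) (fun A x => by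
      change (φ (D.single i hi _)).1 j = slAct (E.wt j) A ((φ (D.single i hi x)).1 j)
      rw [← slIncl_lie_single, LieModuleHom.map_lie, slIncl_lie_apply])
  refine ⟨c, fun h0 => ⟨?_, hc h0⟩, h⟩
  -- Schur's lemma alone does not exclude `j > E.len`, as `E.wt j` is an arbitrary value there. But
  -- the `j`-th coordinate is then zero, and testing on the constant `1` gives `c = 0`.
  by_contra hj
  have h1 : (φ (D.single i hi _)).1 j = c • (1 : F[X]) :=
    h ⟨1, monomial_mem_irr (s := 0) 1 (Or.inl (Nat.zero_le _))⟩
  rw [((φ _).2 j).2 (by omega)] at h1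
  exact smul_ne_zero h0 one_ne_zero h1.symm

/-- Every homomorphism between ladders is a linear combination of shifts. -/
theorem exists_shift_scalars (hD : D.Nondegenerate) (hE : E.Nondegenerate)
    (φ : D.Mod →ₗ⁅F, GalileanAlgebra F n⁆ E.Mod) :
    ∃ γ : ℕ → F, (∀ s, γ s ≠ 0 → D.Shiftable E s) ∧
      ∀ x j, (φ x).1 j = ∑ s ∈ Finset.range (D.len + 1), γ s • x.1 (j + s) := by
  choose c hc h using fun i j (hi : i ≤ D.len) => exists_scalars φ i j hi
  -- The `j`-th coordinate of `φ ⁅p, x⁆ = ⁅p, φ x⁆` for `x` in the layer `i + 1`.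
  have hsucc (i j : ℕ) (hi : i + 1 ≤ D.len) (p : irr F (2 * n - 1)) (x : irr F (D.wt (i + 1))) :
      c i j (by omega) • transvectant (2 * n - 1) (D.wt (i + 1)) (D.tvDeg i) p.1 x.1
      = c (i + 1) (j + 1) hi •
        transvectant (2 * n - 1) (E.wt (j + 1)) (E.tvDeg j) p.1 x.1 := by
    have h1 := congrArg (fun y : E.Mod => y.1 j) (LieModuleHom.map_lie φ (heis p) (D.single (i + 1) hi x))
    simp only [heis_lie_single_succ, heis_lie_apply, h, map_smul] at h1
    exact h1
  have hzero (j : ℕ) (p : irr F (2 * n - 1)) (x : irr F (D.wt 0)) :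
      c 0 (j + 1) (Nat.zero_le _) •
        transvectant (2 * n - 1) (E.wt (j + 1)) (E.tvDeg j) p.1 x.1 = 0 := by
    have h1 := congrArg (fun y : E.Mod => y.1 j)
      (LieModuleHom.map_lie φ (heis p) (D.single 0 (Nat.zero_le _) x))
    simp only [heis_lie_single_zero, heis_lie_apply, h, map_smul, map_zero] at h1
    exact h1.symm
  -- If the right side is zero, nondegeneracy of `D` kills the left side. Otherwise the layer `j +
  -- 1` of `E` exists and the upper weights agree, so nondegeneracy of `E` makes the left side
  -- non-zero; then the lower weights agree too, both sides of `hsucc` involve the same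
  -- transvectant, and a non-zero value of it can be cancelled.
  have tsucc (i j : ℕ) (hi : i + 1 ≤ D.len) : c i j (by omega) = c (i + 1) (j + 1) hi := by
    by_cases h1 : c (i + 1) (j + 1) hi = 0
    · obtain ⟨p, x, hpx⟩ := exists_tv_ne_zero hD (i := i) (by omega)
      have h2 := hsucc i j hi p x
      rw [h1, zero_smul] at h2
      rw [h1]
      exact (smul_eq_zero.1 h2).resolve_right hpx
    · obtain ⟨hj, hw⟩ := hc _ _ _ h1
      obtain ⟨p, x, hpx⟩ := exists_tv_ne_zero hE (i := j) (by omega)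
      have h2 := hsucc i j hi p ⟨x.1, by rw [hw]; exact x.2⟩
      by_cases h0 : c i j (by omega) = 0
      · rw [h0, zero_smul] at h2
        exact absurd h2.symm (smul_ne_zero h1 hpx)
      · have hw' := (hc _ _ _ h0).2
        have e : D.tvDeg i = E.tvDeg j := by rw [tvDeg, tvDeg, hw, hw']
        dsimp only at h2
        rw [e, hw] at h2
        exact smul_left_injective F hpx h2
  -- `V(2n-1)` annihilates the socle layer `V(a_0)` but not the layer `j + 1` of `E`.
  have tzero (j : ℕ) : c 0 (j + 1) (Nat.zero_le _) = 0 := by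
    by_contra h1
    obtain ⟨hj, hw⟩ := hc _ _ _ h1
    obtain ⟨p, x, hpx⟩ := exists_tv_ne_zero hE (i := j) (by omega)
    exact smul_ne_zero h1 hpx (hzero j p ⟨x.1, by rw [hw]; exact x.2⟩)
  have tdiag (j s : ℕ) (hs : j + s ≤ D.len) : c (j + s) j hs = c s 0 (by omega) := by
    induction j with
    | zero => simp
    | succ j ih =>
      rw [← ih (by omega), tsucc (j + s) j (by omega)]
      congr 1
      omega
  have tupper (i j : ℕ) (hi : i ≤ D.len) (hij : i < j) : c i j hi = 0 := by
    induction i generalizing j with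
    | zero =>
      obtain ⟨j, rfl⟩ : ∃ k, j = k + 1 := ⟨j - 1, by omega⟩
      exact tzero j
    | succ i ih =>
      obtain ⟨j, rfl⟩ : ∃ k, j = k + 1 := ⟨j - 1, by omega⟩
      rw [← tsucc i j hi]
      exact ih j (by omega) (by omega)
  refine ⟨fun s => if hs : s ≤ D.len then c s 0 hs else 0, ?_, ?_⟩
  · intro s hs
    by_cases hs' : s ≤ D.len
    · replace hs : c s 0 hs' ≠ 0 := by simpa only [dif_pos hs'] using hs
      refine ⟨hs', ?_, ?_⟩
      -- The last entry of the diagonal, from the layer `D.len` to the layer `D.len - s`, is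
      -- non-zero as well; its target must exist in `E`.
      · have := (hc _ _ _ ((tdiag (D.len - s) s (by omega)).trans_ne hs)).1
        omega
      · intro i hi
        exact (hc _ _ _ ((tdiag i s hi).trans_ne hs)).2
    · exact absurd (dif_neg hs') hs
  · intro x j
    have h1 : (φ x).1 j = ∑ i : Fin (D.len + 1), c i j (by omega) • x.1 i := by
      conv_lhs => rw [← D.sum_single x, map_sum, sum_apply]
      refine Finset.sum_congr rfl fun i _ => ?_
      rw [h]
      rfl
    rw [h1]
    -- The terms contributing to the coordinate `j`, extended by zero. The sum over `range (j +
    -- D.len + 1)` is split in two ways to change the index from `i` to `s = i - j`: the first `j`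
    -- terms vanish by `tupper`, the last `j` because `i > D.len`.
    let g : ℕ → F[X] := fun i => if hi : i ≤ D.len then c i j hi • x.1 i else 0
    have h2 : ∑ i : Fin (D.len + 1), c i j (by omega) • x.1 i
        = ∑ i ∈ Finset.range (D.len + 1), g i := by
      rw [← Fin.sum_univ_eq_sum_range]
      refine Finset.sum_congr rfl fun i _ => ?_
      simp only [g]
      rw [dif_pos (by omega)]
    have h3 (s : ℕ) (hs : s ∈ Finset.range (D.len + 1)) :
        (if hs : s ≤ D.len then c s 0 hs else 0) • x.1 (j + s) = g (j + s) := by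
      have hs' : s ≤ D.len := by simpa [Nat.lt_succ_iff] using hs
      simp only [g]
      rw [dif_pos hs']
      split_ifs with h4
      · rw [tdiag j s h4]
      · rw [(x.2 _).2 (by omega), smul_zero]
    have h4 : ∑ i ∈ Finset.range j, g i = 0 := Finset.sum_eq_zero fun i hi => by
      simp only [g]
      split_ifs with h5
      · rw [tupper i j h5 (Finset.mem_range.1 hi), zero_smul]
      · rfl
    have h5 : ∑ i ∈ Finset.range j, g (D.len + 1 + i) = 0 := Finset.sum_eq_zero fun i _ => by
      simp only [g]
      rw [dif_neg (by omega)]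
    have h6 := Finset.sum_range_add g j (D.len + 1)
    rw [add_comm j, Finset.sum_range_add g (D.len + 1) j, h4, h5, add_zero, zero_add] at h6
    rw [h2, Finset.sum_congr rfl h3, h6]

end Ladder

/-! ### Shifts as homomorphisms, and Hom spaces determined by the admissible shifts. -/

section Hom

variable {n : ℕ} [NeZero n] [CharZero F] {D E : Ladder F n}

/-- The homomorphism given by the arrows `V(a_{i+s}) → V(b_i)`. -/
def Ladder.shift {s : ℕ} (h : D.Shiftable E s)
    (hz : ∀ i, i + s + 2 ≤ D.len → D.zeta (i + s) = E.zeta i) :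
    D.Mod →ₗ⁅F, GalileanAlgebra F n⁆ E.Mod where
  toFun x := ⟨fun j => x.1 (j + s), fun j => by
    refine ⟨fun _ => ?_, fun hj => (x.2 _).2 (by have := h.len_le; omega)⟩
    by_cases hj : j + s ≤ D.len
    · rw [← h.wt_eq j hj]
      exact (x.2 _).1 hj
    · change x.1 (j + s) ∈ _
      rw [(x.2 (j + s)).2 (by omega)]
      exact zero_mem _⟩
  map_add' _ _ := rfl
  map_smul' _ _ := rfl
  map_lie' {g x} := Subtype.ext (funext fun j => by
    change D.act g x.1 (j + s) = E.act g (fun j => x.1 (j + s)) j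
    simp only [Ladder.act]
    rw [show j + 1 + s = j + s + 1 by omega, show j + 2 + s = j + s + 2 by omega]
    -- Weights match only up to `D.len`. Past the end the coordinates of `x` vanish, so the
    -- unrelated weights there do no harm.
    by_cases h0 : D.len < j + s
    · simp [(x.2 (j + s)).2 h0, (x.2 (j + s + 1)).2 (by omega), (x.2 (j + s + 2)).2 (by omega)]
    rw [h.wt_eq j (by omega)]
    by_cases h1 : D.len < j + s + 1
    · simp [(x.2 (j + s + 1)).2 (by omega), (x.2 (j + s + 2)).2 (by omega)]
    have h1' := h.wt_eq (j + 1) (by omega)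
    rw [show j + 1 + s = j + s + 1 by omega] at h1'
    rw [h1']
    by_cases h2 : D.len < j + s + 2
    · simp [(x.2 (j + s + 2)).2 (by omega)]
    rw [hz j (by omega)])

theorem Ladder.shift_apply {s : ℕ} (h : D.Shiftable E s)
    (hz : ∀ i, i + s + 2 ≤ D.len → D.zeta (i + s) = E.zeta i) (x : D.Mod) (j : ℕ) :
    (Ladder.shift h hz x).1 j = x.1 (j + s) := rfl

variable {V W : Type*}
  [AddCommGroup V] [Module F V] [LieRingModule (GalileanAlgebra F n) V]
  [AddCommGroup W] [Module F W] [LieRingModule (GalileanAlgebra F n) W]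
  (eV : V ≃ₗ⁅F, GalileanAlgebra F n⁆ D.Mod) (eW : W ≃ₗ⁅F, GalileanAlgebra F n⁆ E.Mod)

theorem equiv_zero_apply (j : ℕ) : (eV 0).1 j = 0 := by
  rw [show eV 0 = 0 from (eV : V →ₗ[F] D.Mod).map_zero]
  rfl

theorem exists_shift_scalars_of_equiv (hD : D.Nondegenerate) (hE : E.Nondegenerate)
    (φ : V →ₗ⁅F, GalileanAlgebra F n⁆ W) :
    ∃ γ : ℕ → F, (∀ s, γ s ≠ 0 → D.Shiftable E s) ∧
      ∀ x j, (eW (φ x)).1 j = ∑ s ∈ Finset.range (D.len + 1), γ s • (eV x).1 (j + s) := by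
  obtain ⟨γ, h1, h2⟩ := Ladder.exists_shift_scalars hD hE
    ((eW : W →ₗ⁅F, GalileanAlgebra F n⁆ E.Mod).comp
      (φ.comp (eV.symm : D.Mod →ₗ⁅F, GalileanAlgebra F n⁆ V)))
  refine ⟨γ, h1, fun x j => ?_⟩
  rw [← h2 (eV x) j]
  change _ = (eW (φ (eV.symm (eV x)))).1 j
  rw [LieModuleEquiv.symm_apply_apply]

/-- The homomorphism `V → W` given by the arrows `V(a_{i+s}) → V(b_i)`. -/
def shiftHom {s : ℕ} (h : D.Shiftable E s)
    (hz : ∀ i, i + s + 2 ≤ D.len → D.zeta (i + s) = E.zeta i) :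
    V →ₗ⁅F, GalileanAlgebra F n⁆ W :=
  (eW.symm : E.Mod →ₗ⁅F, GalileanAlgebra F n⁆ W).comp
    ((Ladder.shift h hz).comp (eV : V →ₗ⁅F, GalileanAlgebra F n⁆ D.Mod))

theorem apply_shiftHom {s : ℕ} (h : D.Shiftable E s)
    (hz : ∀ i, i + s + 2 ≤ D.len → D.zeta (i + s) = E.zeta i) (x : V) (j : ℕ) :
    (eW (shiftHom eV eW h hz x)).1 j = (eV x).1 (j + s) := by
  change (eW (eW.symm (Ladder.shift h hz (eV x)))).1 j = _
  rw [LieModuleEquiv.apply_symm_apply, Ladder.shift_apply]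

/-- The constant `1` lies in every `V(a)`. The vector obtained from it shows that a shift is
non-zero and that distinct shifts are independent. -/
theorem exists_apply_ne_zero (eV : V ≃ₗ⁅F, GalileanAlgebra F n⁆ D.Mod) {i : ℕ} (hi : i ≤ D.len) :
    ∃ x : V, ∀ j, (eV x).1 j = if j = i then 1 else 0 :=
  ⟨eV.symm (D.single i hi ⟨1, monomial_mem_irr (s := 0) 1 (Or.inl (Nat.zero_le _))⟩), fun j => by
    rw [LieModuleEquiv.apply_symm_apply, Ladder.single_apply]⟩

theorem hom_eq_zero (eV : V ≃ₗ⁅F, GalileanAlgebra F n⁆ D.Mod)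
    (eW : W ≃ₗ⁅F, GalileanAlgebra F n⁆ E.Mod) (hD : D.Nondegenerate) (hE : E.Nondegenerate) (h : ∀ s, ¬ D.Shiftable E s)
    (φ : V →ₗ⁅F, GalileanAlgebra F n⁆ W) : φ = 0 := by
  obtain ⟨γ, h1, h2⟩ := exists_shift_scalars_of_equiv eV eW hD hE φ
  ext x
  apply eW.injective
  ext1 j
  rw [h2, Finset.sum_eq_zero]
  · exact (equiv_zero_apply eW j).symm
  · intro s _
    rw [not_not.1 (fun h0 => h s (h1 s h0)), zero_smul]

theorem exists_smul_of_unique (hD : D.Nondegenerate) (hE : E.Nondegenerate) {s : ℕ}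
    (hs : D.Shiftable E s) (h : ∀ t, D.Shiftable E t → t = s)
    (φ : V →ₗ⁅F, GalileanAlgebra F n⁆ W) :
    ∃ c : F, ∀ x j, (eW (φ x)).1 j = c • (eV x).1 (j + s) := by
  obtain ⟨γ, h1, h2⟩ := exists_shift_scalars_of_equiv eV eW hD hE φ
  refine ⟨γ s, fun x j => ?_⟩
  rw [h2, Finset.sum_eq_single s]
  · intro t _ hts
    rw [not_not.1 (fun h0 => hts (h t (h1 t h0))), zero_smul]
  · intro h3
    exact absurd (Finset.mem_range.2 (Nat.lt_succ_of_le hs.le_len)) h3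

/-- A non-zero multiple of a shift is, on each surviving layer, multiplication by `c` between equal
spaces of polynomials, hence bijective. -/
theorem isArrow_of_apply {s : ℕ} (hs : D.Shiftable E s) {φ : V →ₗ⁅F, GalileanAlgebra F n⁆ W} {c : F}
    (hc : c ≠ 0) (h : ∀ x j, (eW (φ x)).1 j = c • (eV x).1 (j + s)) : IsArrow eV eW s φ := by
  refine fun i hi => ⟨fun his x hx => ?_, fun his => ⟨fun x hx => ?_, fun x hx y hy hxy => ?_,
    fun y hy => ?_⟩⟩
  · apply eW.injective
    ext1 j
    have h1 : (eV x).1 (j + s) = 0 := hx (j + s) (by omega)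
    rw [h, h1, smul_zero, equiv_zero_apply]
  · intro j hj
    have h1 : (eV x).1 (j + s) = 0 := hx (j + s) (by omega)
    exact (h x j).trans (by rw [h1, smul_zero])
  · apply eV.injective
    ext1 j
    by_cases hj : j = i
    · subst hj
      have h1 := h x (j - s)
      rw [hxy, h, Nat.sub_add_cancel his] at h1
      exact (smul_right_injective _ hc h1).symm
    · exact (hx j hj).trans (hy j hj).symm
  · have hw := hs.wt_eq (i - s) (by omega)
    have hl := hs.len_le
    rw [Nat.sub_add_cancel his] at hw
    -- The preimage is the component of `y` divided by `c`, moved back to the layer `i`. It lies in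
    -- `V(a_i)` because `a_i = b_{i-s}`, where `len_le` ensures `i - s ≤ E.len`.
    refine ⟨eV.symm (D.single i hi ⟨c⁻¹ • (eW y).1 (i - s), ?_⟩), ?_, ?_⟩
    · rw [hw]
      exact Submodule.smul_mem _ _ (((eW y).2 _).1 (by omega))
    · intro j hj
      change (eV (eV.symm _)).1 j = 0
      rw [LieModuleEquiv.apply_symm_apply, Ladder.single_apply, if_neg hj]
    · apply eW.injective
      ext1 j
      rw [h, LieModuleEquiv.apply_symm_apply, Ladder.single_apply]
      split_ifs with hj
      · rw [smul_inv_smul₀ hc, ← hj, Nat.add_sub_cancel]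
      · rw [smul_zero]
        exact (hy j (by omega)).symm

variable [LieModule F (GalileanAlgebra F n) W]

/-- The bound `hl` says that at most two layers survive the shift. As `z` moves by two layers, its
scalars in `D` and `E` need not be compared; this is how a faithful module can map non-trivially to
one on which `z` acts by 0. -/
theorem homIsArrow_of_unique (hD : D.Nondegenerate) (hE : E.Nondegenerate) {s : ℕ}
    (hs : D.Shiftable E s) (h : ∀ t, D.Shiftable E t → t = s) (hl : D.len ≤ s + 1) :
    HomIsArrow eV eW s := by
  have hz : ∀ i, i + s + 2 ≤ D.len → D.zeta (i + s) = E.zeta i := by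
    intro i hi
    omega
  refine ⟨finrank_eq_one_iff'.2 ⟨shiftHom eV eW hs hz, fun h0 => ?_, fun φ => ?_⟩, fun φ hφ => ?_⟩
  · obtain ⟨x, hx⟩ := exists_apply_ne_zero eV hs.le_len
    have h1 := apply_shiftHom eV eW hs hz x 0
    rw [h0, hx, if_pos (Nat.zero_add s)] at h1
    exact zero_ne_one ((equiv_zero_apply eW 0).symm.trans h1)
  · obtain ⟨c, hc⟩ := exists_smul_of_unique eV eW hD hE hs h φ
    refine ⟨c, ?_⟩
    ext x
    apply eW.injective
    ext1 j
    rw [hc, ← apply_shiftHom eV eW hs hz]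
    exact congrArg (fun y : E.Mod => y.1 j) ((eW : W →ₗ[F] E.Mod).map_smul c _)
  · obtain ⟨c, hc⟩ := exists_smul_of_unique eV eW hD hE hs h φ
    refine isArrow_of_apply eV eW hs (fun h0 => hφ ?_) hc
    ext x
    apply eW.injective
    ext1 j
    rw [hc, h0, zero_smul]
    exact (equiv_zero_apply eW j).symm

/-- The endomorphisms of a ladder for which exactly the shifts by `0` and by `s` are defined. -/
theorem exists_basis_of_shiftable_zero (eW : W ≃ₗ⁅F, GalileanAlgebra F n⁆ D.Mod)
    (hD : D.Nondegenerate) {s : ℕ} (hs0 : s ≠ 0) (hs : D.Shiftable D s)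
    (h : ∀ t, D.Shiftable D t → t = 0 ∨ t = s) (hl : D.len ≤ s + 1) :
    Module.finrank F (V →ₗ⁅F, GalileanAlgebra F n⁆ W) = 2 ∧
      ∃ φ ψ : V →ₗ⁅F, GalileanAlgebra F n⁆ W,
        IsArrow eV eW s φ ∧ IsArrow eV eW 0 ψ ∧ Function.Bijective ψ ∧
        Submodule.span F {φ, ψ} = ⊤ := by
  have hz : ∀ i, i + s + 2 ≤ D.len → D.zeta (i + s) = D.zeta i := by
    intro i hi
    omega
  have h0 : D.Shiftable D 0 := ⟨Nat.zero_le _, le_rfl, fun _ _ => rfl⟩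
  set φ : V →ₗ⁅F, GalileanAlgebra F n⁆ W := shiftHom eV eW hs hz with hφ
  set ψ : V →ₗ⁅F, GalileanAlgebra F n⁆ W := shiftHom eV eW h0 (fun _ _ => rfl) with hψ
  have happ (c d : F) (x : V) (j : ℕ) :
      (eW ((c • φ + d • ψ) x)).1 j = c • (eV x).1 (j + s) + d • (eV x).1 j := by
    have e : eW ((c • φ + d • ψ) x) = c • eW (φ x) + d • eW (ψ x) := by
      have := (eW : W →ₗ[F] D.Mod).map_add (c • φ x) (d • ψ x)
      rw [map_smul, map_smul] at this
      exact this
    rw [e]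
    change c • (eW (φ x)).1 j + d • (eW (ψ x)).1 j = _
    rw [apply_shiftHom, apply_shiftHom, add_zero]
  have hspan : Submodule.span F {φ, ψ} = ⊤ := by
    rw [eq_top_iff]
    intro χ _
    obtain ⟨γ, h1, h2⟩ := exists_shift_scalars_of_equiv eV eW hD hD χ
    refine Submodule.mem_span_pair.2 ⟨γ s, γ 0, ?_⟩
    ext x
    apply eW.injective
    ext1 j
    -- Only the terms `s` and `0` of the expansion of `χ` in shifts can be non-zero.
    have hsub : ({s, 0} : Finset ℕ) ⊆ Finset.range (D.len + 1) := by
      have := hs.le_len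
      intro t ht
      simp only [Finset.mem_insert, Finset.mem_singleton] at ht
      rw [Finset.mem_range]
      omega
    rw [h2, happ, ← Finset.sum_subset hsub, Finset.sum_pair hs0, add_zero]
    intro t _ ht
    simp only [Finset.mem_insert, Finset.mem_singleton, not_or] at ht
    rw [not_not.1 (fun h3 => (h t (h1 t h3)).elim ht.2 ht.1), zero_smul]
  have hli : LinearIndependent F ![φ, ψ] := by
    rw [LinearIndependent.pair_iff]
    intro c d hcd
    -- A vector in the layer `s` is sent by `φ` to the layer `0` and by `ψ` to the layer `s`. Since
    -- `s ≠ 0`, the coordinates `0` and `s` isolate `c` and `d`.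
    obtain ⟨x, hx⟩ := exists_apply_ne_zero eV hs.le_len
    have hv (j : ℕ) : c • (eV x).1 (j + s) + d • (eV x).1 j = 0 := by
      rw [← happ, hcd]
      exact equiv_zero_apply eW j
    have v1 := hv 0
    have v2 := hv s
    simp only [hx, zero_add, if_true, if_neg hs0.symm, smul_zero, add_zero,
      if_neg (show s + s ≠ s by omega)] at v1 v2
    exact ⟨(smul_eq_zero.1 v1).resolve_right one_ne_zero,
      (smul_eq_zero.1 v2).resolve_right one_ne_zero⟩
  refine ⟨?_, φ, ψ, ?_, ?_, ?_, hspan⟩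
  · have h1 := finrank_span_eq_card hli
    rw [Matrix.range_cons, Matrix.range_cons, Matrix.range_empty, Set.union_empty,
      Set.singleton_union, hspan, finrank_top] at h1
    exact h1
  · exact isArrow_of_apply eV eW hs one_ne_zero fun x j => by rw [apply_shiftHom, one_smul]
  · exact isArrow_of_apply eV eW h0 one_ne_zero fun x j => by rw [apply_shiftHom, one_smul]
  · have e : (ψ : V → W) = (eV.trans eW.symm) := by
      funext x
      apply eW.injective
      ext1 j
      rw [apply_shiftHom]
      change _ = (eW (eW.symm (eV x))).1 j
      rw [LieModuleEquiv.apply_symm_apply, add_zero]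
    rw [e]
    exact ⟨(eV.trans eW.symm).injective, (eV.trans eW.symm).surjective⟩

end Hom

/-! ### Arithmetic of the weights: which shifts exist. -/

section Weights

variable {n : ℕ}

theorem StandardFaithful.len_ladder (σ : StandardFaithful n) : (σ.ladder F).len = 2 := by
  cases σ <;> rfl

theorem StandardFaithful.wt_two (σ : StandardFaithful n) :
    (σ.ladder F).wt 2 = (σ.ladder F).wt 0 := by
  cases σ <;> rfl

theorem StandardFaithful.wt_plus (hn : n = 1) (a : ℕ) :
    ((StandardFaithful.plus hn a).ladder F).wt 0 = a ∧
      ((StandardFaithful.plus hn a).ladder F).wt 1 = a + (2 * n - 1) := ⟨rfl, rfl⟩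

theorem StandardFaithful.wt_minus (hn : n = 1) (a : ℕ) (ha : 1 ≤ a) :
    ((StandardFaithful.minus hn a ha).ladder F).wt 0 = a ∧
      ((StandardFaithful.minus hn a ha).ladder F).wt 1 = a - 1 := ⟨rfl, rfl⟩

theorem StandardFaithful.wt_up (hn : 2 ≤ n) (a : ℕ) (ha : a ≤ 1) :
    ((StandardFaithful.up hn a ha).ladder F).wt 0 = a ∧
      ((StandardFaithful.up hn a ha).ladder F).wt 1 = a + (2 * n - 1) := ⟨rfl, rfl⟩

theorem StandardFaithful.wt_down (hn : 2 ≤ n) :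
    ((StandardFaithful.down hn).ladder F).wt 0 = 1 ∧
      ((StandardFaithful.down hn).ladder F).wt 1 = 2 * n - 1 - 1 := ⟨rfl, rfl⟩

/-- The two weights have opposite parity, as `2n - 1` is odd. The shift by 1 needs `a_1 = b_0` and
the shift by 2 needs `a_0 = b_0`, so they cannot both exist. -/
theorem StandardFaithful.wt_zero_ne_wt_one [NeZero n] (σ : StandardFaithful n) :
    (σ.ladder F).wt 0 ≠ (σ.ladder F).wt 1 := by
  have := NeZero.pos n
  cases σ <;> simp only [wt_plus, wt_minus, wt_up, wt_down] <;> omega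

theorem StandardFaithful.nondegenerate [NeZero n] (σ : StandardFaithful n) :
    (σ.ladder F).Nondegenerate := by
  have := NeZero.pos n
  intro i hi
  rw [len_ladder] at hi
  obtain rfl | rfl : i = 0 ∨ i = 1 := by omega
  · cases σ <;> simp only [Ladder.tvDeg, zero_add, wt_plus, wt_minus, wt_up, wt_down] <;> omega
  · cases σ <;>
      simp only [Ladder.tvDeg, one_add_one_eq_two, wt_two, wt_plus, wt_minus, wt_up, wt_down] <;>
      omega

/-- Two weights pin down the entry of the list, and with it the scalar of `z`. A shift by 0 between
standard faithful modules thus needs no separate comparison of the actions of `z`. -/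
theorem StandardFaithful.eq_of_wt_eq [NeZero n] {σ τ : StandardFaithful n}
    (h0 : (σ.ladder F).wt 0 = (τ.ladder F).wt 0) (h1 : (σ.ladder F).wt 1 = (τ.ladder F).wt 1) :
    σ = τ := by
  cases σ <;> cases τ <;> simp only [wt_plus, wt_minus, wt_up, wt_down] at h0 h1 <;>
    first | (subst h0; rfl) | rfl | (exfalso; omega)

/-- For `n ≥ 2` the weight conditions are contradictory, since the middle weight is at least 2 and
the outer ones are at most 1. For `n = 1` they force opposite signs. -/
theorem twoArrows_iff {σ τ : StandardFaithful n} : TwoArrows σ τ ↔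
    (σ.ladder F).wt 1 = (τ.ladder F).wt 0 ∧ (σ.ladder F).wt 0 = (τ.ladder F).wt 1 := by
  constructor
  · rintro (⟨hn, a, ha, b, h⟩ | ⟨hn, a, b, hb, h⟩) <;>
      simp only [StandardFaithful.wt_plus, StandardFaithful.wt_minus] <;> omega
  · rintro ⟨h0, h1⟩
    cases σ <;> cases τ <;> simp only [StandardFaithful.wt_plus, StandardFaithful.wt_minus,
      StandardFaithful.wt_up, StandardFaithful.wt_down] at h0 h1 <;>
    first
    | exact .minusPlus _ _ _ _ (by omega)
    | exact .plusMinus _ _ _ _ (by omega)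
    | (exfalso; omega)

/-- The transvectants have the extreme degrees: `2n - 1` for `Z(α, ℓ)` and `0`, that is,
multiplication of polynomials, for its dual. -/
theorem TypeZ.nondegenerate (κ : TypeZ) : (κ.ladder F n).Nondegenerate := by
  intro i hi
  rcases κ with ⟨α, ℓ⟩ | ⟨α, ℓ⟩
  · have e : (i + 1) * (2 * n - 1) = i * (2 * n - 1) + (2 * n - 1) := by ring
    simp only [Ladder.tvDeg, TypeZ.ladder, Ladder.zInc, e]
    omega
  · have hi' : i < ℓ := hi
    have e : (ℓ - i) * (2 * n - 1) = (ℓ - (i + 1)) * (2 * n - 1) + (2 * n - 1) := by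
      rw [show ℓ - i = (ℓ - (i + 1)) + 1 by omega]; ring
    simp only [Ladder.tvDeg, TypeZ.ladder, Ladder.zDec, e]
    omega

/-- The weights form an arithmetic progression with non-zero difference. As `a_0 = a_2` in a
standard faithful module, three consecutive layers never match. -/
theorem TypeZ.wt_ne_wt_add_two [NeZero n] (κ : TypeZ) {i : ℕ} (hi : i + 2 ≤ (κ.ladder F n).len) :
    (κ.ladder F n).wt i ≠ (κ.ladder F n).wt (i + 2) := by
  have := NeZero.pos n
  rcases κ with ⟨α, ℓ⟩ | ⟨α, ℓ⟩
  · have e : (i + 2) * (2 * n - 1) = i * (2 * n - 1) + 2 * (2 * n - 1) := by ring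
    simp only [TypeZ.ladder, Ladder.zInc, e]
    omega
  · have hi' : i + 2 ≤ ℓ := hi
    have e : (ℓ - i) * (2 * n - 1) = (ℓ - (i + 2)) * (2 * n - 1) + 2 * (2 * n - 1) := by
      rw [show ℓ - i = (ℓ - (i + 2)) + 2 by omega]; ring
    simp only [TypeZ.ladder, Ladder.zDec, e]
    omega

theorem TypeZ.wt_Z (α ℓ i : ℕ) :
    ((TypeZ.Z α ℓ).ladder F n).wt i = α + i * (2 * n - 1) := rfl

theorem TypeZ.wt_Zdual (α ℓ i : ℕ) :
    ((TypeZ.Zdual α ℓ).ladder F n).wt i = α + (ℓ - i) * (2 * n - 1) := rfl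

theorem TypeZ.len_Z (α ℓ : ℕ) : ((TypeZ.Z α ℓ).ladder F n).len = ℓ := rfl

theorem TypeZ.len_Zdual (α ℓ : ℕ) : ((TypeZ.Zdual α ℓ).ladder F n).len = ℓ := rfl

/-- Put `m = 2n - 1`. Matching `(a_1, a_0)` with `(b_0, b_1)` needs `a_0 = a_1 + m` for `Z`, which
leaves only `FU_a^-` with `n = 1`, and `a_1 = a_0 + m` for the dual, which leaves the entries `plus`
and `up`. -/
theorem twoArrowsToZ_iff {σ : StandardFaithful n} {κ : TypeZ} : TwoArrowsToZ σ κ ↔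
    1 ≤ (κ.ladder F n).len ∧ (σ.ladder F).wt 1 = (κ.ladder F n).wt 0 ∧
      (σ.ladder F).wt 0 = (κ.ladder F n).wt 1 := by
  constructor
  · rintro (⟨rfl, a, ha, b, ℓ, hℓ, h⟩ | ⟨rfl, a, b, ℓ, hℓ, h⟩ | ⟨hn, a, ha⟩)
    · simp only [TypeZ.len_Z, TypeZ.wt_Z, StandardFaithful.wt_minus]
      omega
    · simp only [TypeZ.len_Zdual, TypeZ.wt_Zdual, StandardFaithful.wt_plus]
      omega
    · simp only [TypeZ.len_Zdual, TypeZ.wt_Zdual, StandardFaithful.wt_up]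
      omega
  · rintro ⟨hl, h0, h1⟩
    rcases κ with ⟨α, ℓ⟩ | ⟨α, ℓ⟩
    · simp only [TypeZ.len_Z, TypeZ.wt_Z] at hl h0 h1
      cases σ with
      | plus hn a => rw [(StandardFaithful.wt_plus hn a).1] at h1
                     rw [(StandardFaithful.wt_plus hn a).2] at h0; omega
      | minus hn a ha =>
        simp only [StandardFaithful.wt_minus] at h0 h1
        exact .minus hn a ha α ℓ hl (by omega)
      | up hn a ha => simp only [StandardFaithful.wt_up] at h0 h1; omega
      | down hn => simp only [StandardFaithful.wt_down] at h0 h1; omega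
    · obtain ⟨ℓ, rfl⟩ : ∃ k, ℓ = k + 1 := ⟨ℓ - 1, by simp only [TypeZ.len_Zdual] at hl; omega⟩
      have e : (ℓ + 1) * (2 * n - 1) = ℓ * (2 * n - 1) + (2 * n - 1) := by ring
      simp only [TypeZ.len_Zdual, TypeZ.wt_Zdual, Nat.sub_zero, Nat.add_sub_cancel, e] at hl h0 h1
      cases σ with
      | plus hn a =>
        simp only [StandardFaithful.wt_plus] at h0 h1
        exact .plus hn a α (ℓ + 1) hl (by rw [hn] at h1; omega)
      | minus hn a ha => simp only [StandardFaithful.wt_minus] at h0 h1; omega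
      | up hn a ha =>
        simp only [StandardFaithful.wt_up] at h0 h1
        -- Here `ℓ` is the length minus one and `a = α + ℓ m` with `a ≤ 1 < m`, so `ℓ = 0`: this is
        -- why only `Z(a, 1)^*` occurs for `n ≥ 2`.
        rcases ℓ with _ | ℓ
        · obtain rfl : α = a := by omega
          exact .up hn _ ha
        · have e' : (ℓ + 1) * (2 * n - 1) = ℓ * (2 * n - 1) + (2 * n - 1) := by ring
          omega
      | down hn => simp only [StandardFaithful.wt_down] at h0 h1; omega

/-- Now the top two layers of the type `Z` module are matched with `(a_0, a_1)`, in this order, so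
`Z` and its dual exchange roles: `Z` needs `a_1 = a_0 + m` and the dual `a_1 = a_0 - m`, where `m =
2n - 1`. -/
theorem twoArrowsFromZ_iff {σ : StandardFaithful n} {κ : TypeZ} : TwoArrowsFromZ κ σ ↔
    1 ≤ (κ.ladder F n).len ∧
      (κ.ladder F n).wt ((κ.ladder F n).len - 1) = (σ.ladder F).wt 0 ∧
      (κ.ladder F n).wt (κ.ladder F n).len = (σ.ladder F).wt 1 := by
  constructor
  · rintro (⟨rfl, a, b, ℓ, hℓ, h⟩ | ⟨rfl, a, ha, b, ℓ, hℓ, h⟩ | ⟨hn, a, ha⟩)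
    · simp only [TypeZ.len_Z, TypeZ.wt_Z, StandardFaithful.wt_plus]
      omega
    · simp only [TypeZ.len_Zdual, TypeZ.wt_Zdual, StandardFaithful.wt_minus]
      omega
    · simp only [TypeZ.len_Z, TypeZ.wt_Z, StandardFaithful.wt_up]
      omega
  · rintro ⟨hl, h0, h1⟩
    rcases κ with ⟨α, ℓ⟩ | ⟨α, ℓ⟩
    · obtain ⟨ℓ, rfl⟩ : ∃ k, ℓ = k + 1 := ⟨ℓ - 1, by simp only [TypeZ.len_Z] at hl; omega⟩
      have e : (ℓ + 1) * (2 * n - 1) = ℓ * (2 * n - 1) + (2 * n - 1) := by ring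
      simp only [TypeZ.len_Z, TypeZ.wt_Z, Nat.add_sub_cancel, e] at hl h0 h1
      cases σ with
      | plus hn a =>
        simp only [StandardFaithful.wt_plus] at h0 h1
        exact .plus hn a α (ℓ + 1) hl (by rw [hn] at h0; omega)
      | minus hn a ha => simp only [StandardFaithful.wt_minus] at h0 h1; omega
      | up hn a ha =>
        simp only [StandardFaithful.wt_up] at h0 h1
        rcases ℓ with _ | ℓ
        · obtain rfl : α = a := by omega
          exact .up hn _ ha
        · have e' : (ℓ + 1) * (2 * n - 1) = ℓ * (2 * n - 1) + (2 * n - 1) := by ring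
          omega
      | down hn => simp only [StandardFaithful.wt_down] at h0 h1; omega
    · simp only [TypeZ.len_Zdual, TypeZ.wt_Zdual, Nat.sub_self, zero_mul] at hl h0 h1
      rw [show ℓ - (ℓ - 1) = 1 by omega] at h0
      cases σ with
      | plus hn a => simp only [StandardFaithful.wt_plus] at h0 h1; omega
      | minus hn a ha =>
        simp only [StandardFaithful.wt_minus] at h0 h1
        exact .minus hn a ha α ℓ hl (by omega)
      | up hn a ha => simp only [StandardFaithful.wt_up] at h0 h1; omega
      | down hn => simp only [StandardFaithful.wt_down] at h0 h1; omega

variable {D E : Ladder F n}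

theorem Ladder.shiftable_len_iff : D.Shiftable E D.len ↔ D.wt D.len = E.wt 0 := by
  refine ⟨fun h => ?_, fun h => ⟨le_rfl, by omega, fun i hi => ?_⟩⟩
  · simpa using h.wt_eq 0 (by omega)
  · obtain rfl : i = 0 := by omega
    rwa [zero_add]

theorem Ladder.shiftable_len_sub_one_iff (hl : 1 ≤ D.len) : D.Shiftable E (D.len - 1) ↔
    1 ≤ E.len ∧ D.wt (D.len - 1) = E.wt 0 ∧ D.wt D.len = E.wt 1 := by
  refine ⟨fun h => ⟨?_, ?_, ?_⟩, fun h => ⟨by omega, by omega, fun i hi => ?_⟩⟩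
  · have := h.len_le
    omega
  · simpa using h.wt_eq 0 (by omega)
  · simpa [Nat.add_sub_cancel' hl] using h.wt_eq 1 (by omega)
  · obtain rfl | rfl : i = 0 ∨ i = 1 := by omega
    · rw [zero_add]
      exact h.2.1
    · rw [Nat.add_sub_cancel' hl]
      exact h.2.2

theorem StandardFaithful.shiftable_two_iff {σ : StandardFaithful n} :
    (σ.ladder F).Shiftable E 2 ↔ (σ.ladder F).wt 0 = E.wt 0 := by
  have h := Ladder.shiftable_len_iff (D := σ.ladder F) (E := E)
  rwa [σ.len_ladder, σ.wt_two] at h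

theorem StandardFaithful.shiftable_one_iff {σ : StandardFaithful n} :
    (σ.ladder F).Shiftable E 1 ↔
      1 ≤ E.len ∧ (σ.ladder F).wt 1 = E.wt 0 ∧ (σ.ladder F).wt 0 = E.wt 1 := by
  have h := Ladder.shiftable_len_sub_one_iff (D := σ.ladder F) (E := E)
    (by rw [σ.len_ladder]; omega)
  rwa [σ.len_ladder, σ.wt_two] at h

theorem StandardFaithful.shiftable_cases {σ : StandardFaithful n} {s : ℕ}
    (h : (σ.ladder F).Shiftable E s) : s = 0 ∨ s = 1 ∨ s = 2 := by
  have := h.le_len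
  rw [σ.len_ladder] at this
  omega

theorem not_shiftable_zero_typeZ [NeZero n] (σ : StandardFaithful n) (κ : TypeZ) :
    ¬ (σ.ladder F).Shiftable (κ.ladder F n) 0 := by
  intro h
  have hl := h.len_le
  have h0 := h.wt_eq 0 (Nat.zero_le _)
  have h2 := h.wt_eq 2 (by rw [σ.len_ladder])
  rw [σ.len_ladder] at hl
  exact κ.wt_ne_wt_add_two hl (h0.symm.trans (σ.wt_two.symm.trans h2))

/-- A smaller shift would give `b_s = a_0` and `b_{s+2} = a_2 = a_0`, against monotonicity of the
weights. -/
theorem typeZ_shiftable_cases [NeZero n] {σ : StandardFaithful n} {κ : TypeZ} {s : ℕ}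
    (h : (κ.ladder F n).Shiftable (σ.ladder F) s) :
    s = (κ.ladder F n).len ∨ 1 ≤ (κ.ladder F n).len ∧ s = (κ.ladder F n).len - 1 := by
  have hs := h.le_len
  by_contra hne
  have h0 := h.wt_eq 0 (by omega)
  have h2 := h.wt_eq 2 (by omega)
  rw [zero_add] at h0
  rw [add_comm] at h2
  exact κ.wt_ne_wt_add_two (by omega) (h0.trans (σ.wt_two.symm.trans h2.symm))

theorem StandardFaithful.eq_of_shiftable_zero [NeZero n] {σ τ : StandardFaithful n}
    (h : (σ.ladder F).Shiftable (τ.ladder F) 0) : σ = τ :=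
  eq_of_wt_eq (F := F) (h.wt_eq 0 (Nat.zero_le _)) (h.wt_eq 1 (by rw [σ.len_ladder]; omega))

end Weights

end

end Galilean

/-! ### The main theorem, by elimination of shifts. -/

/-- Intertwining operators between a standard faithful module `V = V(a_0) ⊕ V(a_1) ⊕ V(a_2)` of
`sl(2) ⋉ h_n` and a module `W = V(b_0) ⊕ ⋯ ⊕ V(b_ℓ)` of type `Z` or standard faithful. -/
theorem mainTheorem5 {F : Type*} [Field F] [CharZero F] (n : ℕ) [NeZero n]
    (σ : Galilean.StandardFaithful n)
    {V : Type*} [AddCommGroup V] [Module F V] [LieRingModule (Galilean.GalileanAlgebra F n) V]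
    [LieModule F (Galilean.GalileanAlgebra F n) V]
    (eV : V ≃ₗ⁅F, Galilean.GalileanAlgebra F n⁆ (σ.ladder F).Mod)
    {W : Type*} [AddCommGroup W] [Module F W] [LieRingModule (Galilean.GalileanAlgebra F n) W]
    [LieModule F (Galilean.GalileanAlgebra F n) W] :
    -- `W` is of type `Z`
    (∀ (κ : Galilean.TypeZ)
        (eW : W ≃ₗ⁅F, Galilean.GalileanAlgebra F n⁆ (κ.ladder F n).Mod),
      -- `Hom(V, W)`
      ((σ.ladder F).wt 0 = (κ.ladder F n).wt 0 → Galilean.HomIsArrow eV eW 2) ∧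
      (Galilean.TwoArrowsToZ σ κ → Galilean.HomIsArrow eV eW 1) ∧
      ((σ.ladder F).wt 0 ≠ (κ.ladder F n).wt 0 → ¬ Galilean.TwoArrowsToZ σ κ →
        ∀ φ : V →ₗ⁅F, Galilean.GalileanAlgebra F n⁆ W, φ = 0) ∧
      -- `Hom(W, V)`
      ((κ.ladder F n).wt (κ.ladder F n).len = (σ.ladder F).wt 0 →
        Galilean.HomIsArrow eW eV (κ.ladder F n).len) ∧
      (Galilean.TwoArrowsFromZ κ σ →
        Galilean.HomIsArrow eW eV ((κ.ladder F n).len - 1)) ∧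
      ((κ.ladder F n).wt (κ.ladder F n).len ≠ (σ.ladder F).wt 0 → ¬ Galilean.TwoArrowsFromZ κ σ →
        ∀ φ : W →ₗ⁅F, Galilean.GalileanAlgebra F n⁆ V, φ = 0)) ∧
    -- `W` is standard faithful
    (∀ (τ : Galilean.StandardFaithful n)
        (eW : W ≃ₗ⁅F, Galilean.GalileanAlgebra F n⁆ (τ.ladder F).Mod),
      ((σ.ladder F).wt 0 = (τ.ladder F).wt 0 →
        (Nonempty (V ≃ₗ⁅F, Galilean.GalileanAlgebra F n⁆ W) ↔
          (σ.ladder F).wt 1 = (τ.ladder F).wt 1) ∧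
        (¬ Nonempty (V ≃ₗ⁅F, Galilean.GalileanAlgebra F n⁆ W) → Galilean.HomIsArrow eV eW 2) ∧
        (Nonempty (V ≃ₗ⁅F, Galilean.GalileanAlgebra F n⁆ W) →
          Module.finrank F (V →ₗ⁅F, Galilean.GalileanAlgebra F n⁆ W) = 2 ∧
          ∃ φ ψ : V →ₗ⁅F, Galilean.GalileanAlgebra F n⁆ W,
            Galilean.IsArrow eV eW 2 φ ∧ Galilean.IsArrow eV eW 0 ψ ∧ Function.Bijective ψ ∧
            Submodule.span F {φ, ψ} = ⊤)) ∧
      (Galilean.TwoArrows σ τ → Galilean.HomIsArrow eV eW 1) ∧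
      ((σ.ladder F).wt 0 ≠ (τ.ladder F).wt 0 → ¬ Galilean.TwoArrows σ τ →
        ∀ φ : V →ₗ⁅F, Galilean.GalileanAlgebra F n⁆ W, φ = 0)) := by
  have hσ := σ.nondegenerate (F := F)
  have hσl := σ.len_ladder (F := F)
  have hσw := σ.wt_zero_ne_wt_one (F := F)
  refine ⟨fun κ eW => ?_, fun τ eW => ?_⟩
  · have hκ := κ.nondegenerate (F := F) (n := n)
    have h0 := Galilean.not_shiftable_zero_typeZ (F := F) σ κ
    have h1 := Galilean.StandardFaithful.shiftable_one_iff (σ := σ) (E := κ.ladder F n)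
    have h2 := Galilean.StandardFaithful.shiftable_two_iff (σ := σ) (E := κ.ladder F n)
    have h1' := Galilean.twoArrowsToZ_iff (F := F) (σ := σ) (κ := κ)
    have g1 := Galilean.Ladder.shiftable_len_iff (D := κ.ladder F n) (E := σ.ladder F)
    have g2 := fun hl =>
      Galilean.Ladder.shiftable_len_sub_one_iff (D := κ.ladder F n) (E := σ.ladder F) hl
    have g2' := Galilean.twoArrowsFromZ_iff (F := F) (σ := σ) (κ := κ)
    refine ⟨fun h => ?_, fun h => ?_, fun h h' => ?_, fun h => ?_, fun h => ?_, fun h h' => ?_⟩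
    · refine Galilean.homIsArrow_of_unique eV eW hσ hκ (h2.2 h) (fun t ht => ?_) (by omega)
      rcases Galilean.StandardFaithful.shiftable_cases ht with rfl | rfl | rfl
      · exact absurd ht h0
      -- A shift by 1 next to the shift by 2 would give `a_0 = b_0 = a_1`.
      · exact absurd (h.trans (h1.1 ht).2.1.symm) hσw
      · rfl
    · refine Galilean.homIsArrow_of_unique eV eW hσ hκ (h1.2 (h1'.1 h)) (fun t ht => ?_) (by omega)
      rcases Galilean.StandardFaithful.shiftable_cases ht with rfl | rfl | rfl
      · exact absurd ht h0
      · rfl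
      · exact absurd ((h2.1 ht).trans (h1'.1 h).2.1.symm) hσw
    · refine Galilean.hom_eq_zero eV eW hσ hκ fun t ht => ?_
      rcases Galilean.StandardFaithful.shiftable_cases ht with rfl | rfl | rfl
      · exact h0 ht
      · exact h' (h1'.2 (h1.1 ht))
      · exact h (h2.1 ht)
    · refine Galilean.homIsArrow_of_unique eW eV hκ hσ (g1.2 h) (fun t ht => ?_) (by omega)
      rcases Galilean.typeZ_shiftable_cases ht with rfl | ⟨hl, rfl⟩
      · rfl
      · exact absurd (h.symm.trans ((g2 hl).1 ht).2.2) hσw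
    · have hl := (g2'.1 h).1
      refine Galilean.homIsArrow_of_unique eW eV hκ hσ
        ((g2 hl).2 ⟨by omega, (g2'.1 h).2⟩) (fun t ht => ?_) (by omega)
      rcases Galilean.typeZ_shiftable_cases ht with rfl | ⟨hl, rfl⟩
      · exact absurd ((g1.1 ht).symm.trans (g2'.1 h).2.2) hσw
      · rfl
    · refine Galilean.hom_eq_zero eW eV hκ hσ fun t ht => ?_
      rcases Galilean.typeZ_shiftable_cases ht with rfl | ⟨hl, rfl⟩
      · exact h (g1.1 ht)
      · exact h' (g2'.2 ⟨hl, ((g2 hl).1 ht).2⟩)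
  · have hτ := τ.nondegenerate (F := F)
    have hτl := τ.len_ladder (F := F)
    have h1 := Galilean.StandardFaithful.shiftable_one_iff (σ := σ) (E := τ.ladder F)
    have h2 := Galilean.StandardFaithful.shiftable_two_iff (σ := σ) (E := τ.ladder F)
    have h1' := Galilean.twoArrows_iff (F := F) (σ := σ) (τ := τ)
    have huniq (h : (σ.ladder F).wt 0 = (τ.ladder F).wt 0) (t : ℕ)
        (ht : (σ.ladder F).Shiftable (τ.ladder F) t) : t = 0 ∨ t = 2 := by
      rcases Galilean.StandardFaithful.shiftable_cases ht with rfl | rfl | rfl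
      · exact Or.inl rfl
      · exact absurd (h.trans (h1.1 ht).2.1.symm) hσw
      · exact Or.inr rfl
    refine ⟨fun h => ?_, fun h => ?_, fun h h' => ?_⟩
    · have hiso : (σ.ladder F).wt 1 = (τ.ladder F).wt 1 →
          Nonempty (V ≃ₗ⁅F, Galilean.GalileanAlgebra F n⁆ W) := by
        intro hw
        obtain rfl := Galilean.StandardFaithful.eq_of_wt_eq h hw
        exact ⟨eV.trans eW.symm⟩
      have harrow (hw : (σ.ladder F).wt 1 ≠ (τ.ladder F).wt 1) : Galilean.HomIsArrow eV eW 2 := by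
        refine Galilean.homIsArrow_of_unique eV eW hσ hτ (h2.2 h) (fun t ht => ?_) (by omega)
        rcases huniq h t ht with rfl | rfl
        · exact absurd (congrArg (fun ρ => (ρ.ladder F).wt 1)
            (Galilean.StandardFaithful.eq_of_shiftable_zero ht)) hw
        · rfl
      -- If `a_1 ≠ b_1`, every non-zero homomorphism is an arrow with shift 2 and kills `V(a_0)`, so
      -- it is not injective.
      have hwt (e : V ≃ₗ⁅F, Galilean.GalileanAlgebra F n⁆ W) :
          (σ.ladder F).wt 1 = (τ.ladder F).wt 1 := by
        by_contra hw
        obtain ⟨x, hx⟩ := Galilean.exists_apply_ne_zero eV (Nat.zero_le _)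
        have hx0 : x ≠ 0 := by
          rintro rfl
          have := hx 0
          rw [Galilean.equiv_zero_apply, if_pos rfl] at this
          exact zero_ne_one this
        have hex : e x ≠ 0 := fun h0 =>
          hx0 (e.injective (h0.trans (e : V →ₗ[F] W).map_zero.symm))
        have harr := (harrow hw).2 e fun h0 => hex
          (congrArg (fun φ : V →ₗ⁅F, Galilean.GalileanAlgebra F n⁆ W => φ x) h0)
        exact hex ((harr 0 (Nat.zero_le _)).1 (by omega) x fun j hj =>
          (hx j).trans (if_neg hj))
      refine ⟨⟨fun ⟨e⟩ => hwt e, hiso⟩, fun hn => harrow fun hw => hn (hiso hw), fun ⟨e⟩ => ?_⟩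
      obtain rfl := Galilean.StandardFaithful.eq_of_wt_eq h (hwt e)
      exact Galilean.exists_basis_of_shiftable_zero eV eW hσ two_ne_zero (h2.2 h) (huniq h)
        (by omega)
    · have h3 := h1'.1 h
      refine Galilean.homIsArrow_of_unique eV eW hσ hτ (h1.2 ⟨by omega, h3⟩) (fun t ht => ?_)
        (by omega)
      rcases Galilean.StandardFaithful.shiftable_cases ht with rfl | rfl | rfl
      -- A shift by 0 makes the two modules equal; the condition `a_1 = b_0` for two arrows would
      -- then read `a_1 = a_0`.
      · obtain rfl := Galilean.StandardFaithful.eq_of_shiftable_zero ht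
        exact absurd h3.1.symm hσw
      · rfl
      · exact absurd ((h2.1 ht).trans h3.1.symm) hσw
    · refine Galilean.hom_eq_zero eV eW hσ hτ fun t ht => ?_
      rcases Galilean.StandardFaithful.shiftable_cases ht with rfl | rfl | rfl
      · obtain rfl := Galilean.StandardFaithful.eq_of_shiftable_zero ht
        exact h rfl
      · exact h' (h1'.2 (h1.1 ht).2)
      · exact h (h2.1 ht)
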